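/- Let $M$ be a closed smooth manifold of dimension $2n+1$ and let $\alpha$ be a contact form on $M$, that is, a smooth $1$-form such that $\mu := \alpha\wedge(d\alpha)^n$ vanishes nowhere. Its Reeb vector field $R_\alpha$ is determined by $\alpha(R_\alpha)=1$, $\iota(R_\alpha)d\alpha=0$, and a function $F$ on $M$ is called basic if $dF(R_\alpha)=0$. A vector field $X$ is called contact if $\mathcal L_X\alpha=h\alpha$ for some smooth function $h$ on $M$, and strictly contact if $\mathcal L_X\alpha=0$. Let $\{X_t\}_{0\le t\le 1}$ be a smooth family of vector fields on $M$ and let $H_t:=\alpha(X_t)$. (a) For each $t\in[0,1]$, $X_t$ is strictly contact if and only if $X_t$ is contact and $H_t$ is basic. (b) Suppose that $X_t$ is strictly contact for all $t\in[0,1]$. Then each form $H_t\,(d\alpha)^n$, $0\le t\le1$, is smooth and closed, the $2n$-forms $\int_0^1\iota(X_t)\mu\,dt$ and $\left(\int_0^1H_t\,dt\right)(d\alpha)^n$ are smooth and closed, and the volume flux of $\{X_t\}$ is $$\mathrm{Flux}(\{X_t\}) := \left[\int_0^1\iota(X_t)\mu\,dt\right] = (n+1)\left[\int_0^1H_t\,dt\cdot(d\alpha)^n\right]\in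 H^{2n}(M,\mathbb R),$$ where $H^{2n}(M,\mathbb R)$ denotes de Rham cohomology. -/

import Mathlib

open Set
open scoped Manifold ContDiff Topology

noncomputable section

/-! ## Multilinear algebra -/

section Algebra

variable {V : Type*} [AddCommGroup V] [Module ℝ V] [TopologicalSpace V]

/-- The continuous multilinear form
`(v₀, …, v_{p+q-1}) ↦ a (v₀, …, v_{p-1}) * b (v_p, …, v_{p+q-1})`,
where the total degree `r = p + q` is recorded by an equation. -/
def tensorForm {p q r : ℕ} (h : p + q = r) (a : V [⋀^Fin p]→L[ℝ] ℝ) (b : V [⋀^Fin q]→L[ℝ] ℝ) :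
    ContinuousMultilinearMap ℝ (fun _ : Fin r => V) ℝ where
  toMultilinearMap :=
    ((LinearMap.mul' ℝ ℝ).compMultilinearMap
      (MultilinearMap.domCoprod a.toMultilinearMap b.toMultilinearMap)).domDomCongr
        (finSumFinEquiv.trans (finCongr h))
  cont := by
    change Continuous fun v : Fin r → V =>
      a (fun i => v (Fin.cast h (Fin.castAdd q i))) * b (fun j => v (Fin.cast h (Fin.natAdd p j)))
    refine (a.cont.comp ?_).mul (b.cont.comp ?_) <;> fun_prop

theorem tensorForm_apply {p q r : ℕ} (h : p + q = r) (a : V [⋀^Fin p]→L[ℝ] ℝ)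
    (b : V [⋀^Fin q]→L[ℝ] ℝ) (v : Fin r → V) :
    tensorForm h a b v =
      a (fun i => v (Fin.cast h (Fin.castAdd q i))) *
        b (fun j => v (Fin.cast h (Fin.natAdd p j))) := rfl

/-- The wedge product of alternating forms:
`(a ∧ b)(v) = 1 / (p! q!) * ∑ σ, sign σ * a (v_{σ 0}, …) * b (…, v_{σ (p+q-1)})`.
This normalisation is the one that goes with the exterior derivative `extDeriv` of Mathlib. -/
def wedge {p q r : ℕ} (h : p + q = r) (a : V [⋀^Fin p]→L[ℝ] ℝ) (b : V [⋀^Fin q]→L[ℝ] ℝ) :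
    V [⋀^Fin r]→L[ℝ] ℝ :=
  ((p.factorial : ℝ) * (q.factorial : ℝ))⁻¹ •
    ContinuousMultilinearMap.alternatization (tensorForm h a b)

theorem wedge_apply {p q r : ℕ} (h : p + q = r) (a : V [⋀^Fin p]→L[ℝ] ℝ)
    (b : V [⋀^Fin q]→L[ℝ] ℝ) (v : Fin r → V) :
    wedge h a b v = ((p.factorial : ℝ) * (q.factorial : ℝ))⁻¹ *
      ∑ σ : Equiv.Perm (Fin r), ((Equiv.Perm.sign σ : ℤ) : ℝ) *
        (a (fun i => v (σ (Fin.cast h (Fin.castAdd q i)))) *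
          b (fun j => v (σ (Fin.cast h (Fin.natAdd p j))))) := by
  simp [wedge, ContinuousMultilinearMap.alternatization_apply_apply, tensorForm_apply,
    Units.smul_def]

/-- The powers `b ∧ ⋯ ∧ b` (`m` factors) of a `2`-form. -/
def wedgePow (b : V [⋀^Fin 2]→L[ℝ] ℝ) : (m : ℕ) → V [⋀^Fin (2 * m)]→L[ℝ] ℝ
  | 0 => ContinuousAlternatingMap.constOfIsEmpty ℝ V (Fin 0) 1
  | m + 1 => wedge (Nat.mul_succ 2 m).symm (wedgePow b m) b

end Algebra

/-! ## Differential forms on a manifold without boundary, modelled on `E` -/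

section Manifold

variable {E : Type*} [NormedAddCommGroup E] [NormedSpace ℝ E]
  {M : Type*} [TopologicalSpace M] [ChartedSpace E M]

variable (E M) in
/-- Vector fields on `M` (not necessarily smooth). -/
abbrev VField : Type _ := (x : M) → TangentSpace 𝓘(ℝ, E) x

variable (E M) in
/-- Differential `k`-forms on `M` (not necessarily smooth). -/
def DForm (k : ℕ) : Type _ := (x : M) → TangentSpace 𝓘(ℝ, E) x [⋀^Fin k]→L[ℝ] ℝ

/-- Forms are added pointwise. -/
instance DForm.instAddCommGroup (k : ℕ) : AddCommGroup (DForm E M k) :=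
  inferInstanceAs (AddCommGroup ((x : M) → TangentSpace 𝓘(ℝ, E) x [⋀^Fin k]→L[ℝ] ℝ))

/-- Forms are multiplied by real numbers pointwise. -/
instance DForm.instModule (k : ℕ) : Module ℝ (DForm E M k) :=
  inferInstanceAs (Module ℝ ((x : M) → TangentSpace 𝓘(ℝ, E) x [⋀^Fin k]→L[ℝ] ℝ))

/-- The differential at `y` of the inverse of the preferred chart around `x₀`. -/
def chartInvDeriv (x₀ : M) (y : E) : E →L[ℝ] TangentSpace 𝓘(ℝ, E) ((chartAt E x₀).symm y) :=
  mfderiv 𝓘(ℝ, E) 𝓘(ℝ, E) (chartAt E x₀).symm y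

/-- The differential at `x` of the preferred chart around `x₀`. -/
def chartDeriv (x₀ x : M) : TangentSpace 𝓘(ℝ, E) x →L[ℝ] E :=
  mfderiv 𝓘(ℝ, E) 𝓘(ℝ, E) (chartAt E x₀) x

/-- A differential form read in the preferred chart around `x₀`: its pullback by the inverse of
the chart (meaningful on the target of the chart). -/
def DForm.inChart {k : ℕ} (β : DForm E M k) (x₀ : M) (y : E) : E [⋀^Fin k]→L[ℝ] ℝ :=
  (β ((chartAt E x₀).symm y)).compContinuousLinearMap (chartInvDeriv x₀ y)

/-- A vector field read in the preferred chart around `x₀`: its pushforward by the chart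
(meaningful on the target of the chart). -/
def VField.inChart (X : VField E M) (x₀ : M) (y : E) : E :=
  chartDeriv x₀ ((chartAt E x₀).symm y) (X ((chartAt E x₀).symm y))

/-- Smoothness of a differential form: its expressions in charts are smooth. -/
def DForm.Smooth {k : ℕ} (β : DForm E M k) : Prop :=
  ∀ x₀ : M, ContDiffOn ℝ ∞ (β.inChart x₀) (chartAt E x₀).target

/-- The exterior derivative, computed at `x` in the preferred chart around `x`. -/
def DForm.d {k : ℕ} (β : DForm E M k) : DForm E M (k + 1) := fun x =>
  (extDeriv (β.inChart x) (chartAt E x x)).compContinuousLinearMap (chartDeriv x x)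

/-- The interior product `ι(X) β`. -/
def interiorProd {k : ℕ} (X : VField E M) (β : DForm E M (k + 1)) : DForm E M k := fun x =>
  ContinuousAlternatingMap.curryLeft (E := E) (β x) (X x)

/-- The product of a function and a form. -/
def DForm.fmul {k : ℕ} (f : M → ℝ) (β : DForm E M k) : DForm E M k := fun x => f x • β x

/-- The wedge product of differential forms. -/
def DForm.wedge {p q r : ℕ} (h : p + q = r) (β : DForm E M p) (η : DForm E M q) :
    DForm E M r := fun x => _root_.wedge h (β x) (η x)

/-- The powers of a differential `2`-form. -/
def DForm.pow (β : DForm E M 2) (m : ℕ) : DForm E M (2 * m) := fun x => wedgePow (β x) m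

/-- The Lie derivative `L_X α` of a `1`-form, computed at `x` in the preferred chart around `x`
by the coordinate formula `(L_X α)_i = ∑ j, (X^j ∂_j α_i + α_j ∂_i X^j)`. -/
def lieDerivOneForm (X : VField E M) (α : DForm E M 1) : DForm E M 1 := fun x =>
  (fderiv ℝ (α.inChart x) (chartAt E x x) (X.inChart x (chartAt E x x)) +
    (α.inChart x (chartAt E x x)).compContinuousLinearMap
      (fderiv ℝ (X.inChart x) (chartAt E x x))).compContinuousLinearMap (chartDeriv x x)

/-! ### De Rham cohomology -/

theorem DForm.inChart_add {k : ℕ} (β η : DForm E M k) (x₀ : M) :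
    (β + η).inChart x₀ = β.inChart x₀ + η.inChart x₀ := rfl

theorem DForm.inChart_smul {k : ℕ} (c : ℝ) (β : DForm E M k) (x₀ : M) :
    (c • β).inChart x₀ = c • β.inChart x₀ := rfl

theorem DForm.inChart_zero {k : ℕ} (x₀ : M) : DForm.inChart (0 : DForm E M k) x₀ = 0 := rfl

theorem DForm.Smooth.zero {k : ℕ} : DForm.Smooth (0 : DForm E M k) := fun x₀ => by
  rw [DForm.inChart_zero]
  exact contDiffOn_const

theorem DForm.Smooth.add {k : ℕ} {β η : DForm E M k} (hβ : β.Smooth) (hη : η.Smooth) :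
    (β + η).Smooth := fun x₀ => by
  rw [DForm.inChart_add]
  exact (hβ x₀).add (hη x₀)

theorem DForm.Smooth.smul {k : ℕ} (c : ℝ) {β : DForm E M k} (hβ : β.Smooth) :
    (c • β).Smooth := fun x₀ => by
  rw [DForm.inChart_smul]
  exact (hβ x₀).const_smul c

theorem DForm.Smooth.differentiableAt {k : ℕ} {β : DForm E M k} (hβ : β.Smooth) (x : M) :
    DifferentiableAt ℝ (β.inChart x) (chartAt E x x) :=
  ((hβ x).contDiffAt ((chartAt E x).open_target.mem_nhds (mem_chart_target E x))).differentiableAt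
    (by simp)

theorem DForm.d_add {k : ℕ} {β η : DForm E M k} (hβ : β.Smooth) (hη : η.Smooth) :
    (β + η).d = β.d + η.d := by
  funext x
  change (extDeriv (β.inChart x + η.inChart x) (chartAt E x x)).compContinuousLinearMap _ = _
  rw [extDeriv_add (hβ.differentiableAt x) (hη.differentiableAt x)]
  rfl

theorem DForm.d_smul {k : ℕ} (c : ℝ) (β : DForm E M k) : (c • β).d = c • β.d := by
  funext x
  change (extDeriv (c • β.inChart x) (chartAt E x x)).compContinuousLinearMap _ = _
  rw [extDeriv_smul]
  rfl

theorem DForm.d_zero {k : ℕ} : DForm.d (0 : DForm E M k) = 0 := by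
  simpa using DForm.d_smul (0 : ℝ) (0 : DForm E M k)

variable (E M) in
/-- The space of closed smooth `k`-forms. -/
def closedForms (k : ℕ) : Submodule ℝ (DForm E M k) where
  carrier := {β | β.Smooth ∧ β.d = 0}
  zero_mem' := ⟨DForm.Smooth.zero, DForm.d_zero⟩
  add_mem' h₁ h₂ := ⟨h₁.1.add h₂.1, by rw [DForm.d_add h₁.1 h₂.1, h₁.2, h₂.2, add_zero]⟩
  smul_mem' c _ h := ⟨h.1.smul c, by rw [DForm.d_smul, h.2, smul_zero]⟩

variable (E M) in
/-- The space of exact `k`-forms: the differentials of smooth `(k-1)`-forms, and only `0` in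
degree `0`. -/
def exactForms : (k : ℕ) → Submodule ℝ (DForm E M k)
  | 0 => ⊥
  | k + 1 =>
    { carrier := {β | ∃ η : DForm E M k, η.Smooth ∧ η.d = β}
      zero_mem' := ⟨0, DForm.Smooth.zero, DForm.d_zero⟩
      add_mem' := by
        rintro _ _ ⟨η₁, h₁, rfl⟩ ⟨η₂, h₂, rfl⟩
        exact ⟨η₁ + η₂, h₁.add h₂, DForm.d_add h₁ h₂⟩
      smul_mem' := by
        rintro c _ ⟨η, h, rfl⟩
        exact ⟨c • η, h.smul c, DForm.d_smul c η⟩ }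

variable (E M) in
/-- The de Rham cohomology space `H^k(M, ℝ)`: closed smooth forms modulo exact ones. -/
abbrev DeRham (k : ℕ) : Type _ :=
  closedForms E M k ⧸ (exactForms E M k).submoduleOf (closedForms E M k)

/-- The cohomology class of a closed smooth form. -/
def deRhamClass {k : ℕ} (β : DForm E M k) (hβ : β ∈ closedForms E M k) : DeRham E M k :=
  Submodule.Quotient.mk ⟨β, hβ⟩

/-! ### Time-dependent families -/

/-- A family of vector fields `X t`, `0 ≤ t ≤ 1`, is smooth if `(t, x) ↦ X t x` is smooth on
`[0, 1] × M`. -/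
def SmoothFamily [IsManifold 𝓘(ℝ, E) ∞ M] (X : ℝ → VField E M) : Prop :=
  ContMDiffOn (𝓘(ℝ, ℝ).prod 𝓘(ℝ, E)) 𝓘(ℝ, E).tangent ∞
    (fun p : ℝ × M => (⟨p.2, X p.1 p.2⟩ : TangentBundle 𝓘(ℝ, E) M)) (Icc 0 1 ×ˢ univ)

/-- The integral `∫₀¹ β_t dt` of a time-dependent form, taken pointwise on `M`. -/
def DForm.timeIntegral {k : ℕ} (β : ℝ → DForm E M k) : DForm E M k := fun x =>
  (∫ t in (0 : ℝ)..1, (show E [⋀^Fin k]→L[ℝ] ℝ from β t x) : E [⋀^Fin k]→L[ℝ] ℝ)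

/-- The form `∫₀¹ ι(X_t) μ dt`, whose class is the volume flux of the family `X`. -/
def fluxForm {k : ℕ} (μ : DForm E M (k + 1)) (X : ℝ → VField E M) : DForm E M k :=
  DForm.timeIntegral fun t => interiorProd (X t) μ

/-! ### Contact geometry -/

/-- The form `α ∧ (dα)^n`. -/
def contactVolume (n : ℕ) (α : DForm E M 1) : DForm E M (2 * n + 1) :=
  DForm.wedge (Nat.add_comm 1 (2 * n)) α (α.d.pow n)

/-- `α` is a contact form on `M` (of dimension `2n+1`): it is smooth and `α ∧ (dα)^n` vanishes
nowhere. -/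
structure IsContactForm (n : ℕ) (α : DForm E M 1) : Prop where
  smooth : α.Smooth
  ne_zero : ∀ x : M, contactVolume n α x ≠ 0

/-- The function `α(X)`. -/
def contactHamiltonian (α : DForm E M 1) (X : VField E M) : M → ℝ := fun x => α x ![X x]

/-- `X` is a contact vector field: `L_X α = h α` for a smooth function `h`. -/
def IsContactField (α : DForm E M 1) (X : VField E M) : Prop :=
  ∃ h : M → ℝ, ContMDiff 𝓘(ℝ, E) 𝓘(ℝ, ℝ) ∞ h ∧ lieDerivOneForm X α = DForm.fmul h α

/-- `X` is a strictly contact vector field: `L_X α = 0`. -/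
def IsStrictlyContact (α : DForm E M 1) (X : VField E M) : Prop :=
  lieDerivOneForm X α = 0

/-- `v` is the value at `x` of the Reeb vector field: `α(v) = 1` and `ι(v) dα = 0`. -/
def IsReebVector (α : DForm E M 1) (x : M) (v : TangentSpace 𝓘(ℝ, E) x) : Prop :=
  α x ![v] = 1 ∧ ∀ w : TangentSpace 𝓘(ℝ, E) x, α.d x ![v, w] = 0

/-- The function `H` is basic: its derivative along the Reeb vector field vanishes. -/
def IsBasic (α : DForm E M 1) (H : M → ℝ) : Prop :=
  ∀ (x : M) (v : TangentSpace 𝓘(ℝ, E) x), IsReebVector α x v →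
    mfderiv 𝓘(ℝ, E) 𝓘(ℝ, ℝ) H x v = 0

end Manifold

end

/-! Write `μ = α ∧ (dα)^n`. Everything rests on Cartan's formula `L_X α = dH + ι(X)dα` with `H =
α(X)` (`lieDerivOneForm_eq`).

For (a), if `L_X α = hα`, evaluation on a Reeb vector gives `h = dH(R)`, so `h` vanishes when `H` is
basic. Conversely `L_X α = 0` forces `dH(R) = 0`. A Reeb vector exists at each point because a
2-form in odd dimension has a kernel, on which `α` cannot vanish when `μ ≠ 0`
(`exists_reeb_vector`).

For (b), `dH = -ι(X)dα`. Then `d(H(dα)^n) = -ι(X)dα ∧ (dα)^n` is a multiple of `ι(X)(dα)^(n+1)`,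
which is zero for reasons of degree (`extDeriv_smul_wedgePow_eq_zero`). For `n ≥ 1`, expanding
`ι(X)μ = H(dα)^n - n α ∧ ι(X)dα ∧ (dα)^(n-1)` and `d(H α ∧ (dα)^(n-1)) = dH ∧ α ∧ (dα)^(n-1) +
H(dα)^n` gives `ι(X)μ + n d(H α ∧ (dα)^(n-1)) = (n+1) H(dα)^n`, which is
`interiorProd_contactVolume_succ`; closedness of `ι(X)μ` and the equality of classes both follow.

The family is reduced to one field. All the objects are linear in `X`, so the flux form and the
integrated Hamiltonian are those of the time average of `X_t`, which is smooth and again strictly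
contact (`SmoothFamily.isStrictlyContact_timeAverage`).

Wedge identities are handled through `alternize`, a signed sum of `k+1` terms; `alternize_swap` and
`alternize_cons` play the roles of anticommutativity and of the antiderivation rule for `ι(X)`. -/

noncomputable section

/-! ## Antisymmetrisation in one argument -/

section Antisymmetrisation

variable {V : Type*} {k : ℕ}

/-- Antisymmetrisation of a function of a vector and of a `k`-tuple of vectors which is thought of
as alternating in the tuple. -/
def alternize (g : V → (Fin k → V) → ℝ) (v : Fin (k + 1) → V) : ℝ :=
  ∑ i : Fin (k + 1), (-1) ^ (i : ℕ) * g (v i) (i.removeNth v)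

theorem alternize_add (g g' : V → (Fin k → V) → ℝ) (v : Fin (k + 1) → V) :
    alternize (fun u z => g u z + g' u z) v = alternize g v + alternize g' v := by
  simp [alternize, mul_add, Finset.sum_add_distrib]

theorem alternize_sub (g g' : V → (Fin k → V) → ℝ) (v : Fin (k + 1) → V) :
    alternize (fun u z => g u z - g' u z) v = alternize g v - alternize g' v := by
  simp [alternize, mul_sub, Finset.sum_sub_distrib]

theorem alternize_neg (g : V → (Fin k → V) → ℝ) (v : Fin (k + 1) → V) :
    alternize (fun u z => -g u z) v = -alternize g v := by
  simp [alternize]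

theorem alternize_const_mul (c : ℝ) (g : V → (Fin k → V) → ℝ) (v : Fin (k + 1) → V) :
    alternize (fun u z => c * g u z) v = c * alternize g v := by
  simp [alternize, Finset.mul_sum, mul_left_comm]

theorem alternize_congr {k : ℕ} {g g' : V → (Fin k → V) → ℝ} (h : ∀ u z, g u z = g' u z)
    (v : Fin (k + 1) → V) : alternize g v = alternize g' v := by
  rw [show g = g' from funext₂ h]

theorem alternize_zero (v : Fin (k + 1) → V) :
    alternize (fun (_ : V) (_ : Fin k → V) => (0 : ℝ)) v = 0 := by
  simp [alternize]

theorem alternize_fun_add (g g' : V → (Fin k → V) → ℝ) :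
    alternize (fun u z => g u z + g' u z) = fun v => alternize g v + alternize g' v :=
  funext (alternize_add g g')

theorem alternize_fun_neg (g : V → (Fin k → V) → ℝ) :
    alternize (fun u z => -g u z) = fun v => -alternize g v :=
  funext (alternize_neg g)

theorem alternize_fun_zero :
    alternize (fun (_ : V) (_ : Fin k → V) => (0 : ℝ)) = fun _ => 0 :=
  funext alternize_zero

theorem alternize_cons_zero (g : V → (Fin 0 → V) → ℝ) (X : V) (v : Fin 0 → V) :
    alternize g (Matrix.vecCons X v) = g X v := by
  simp [alternize, Matrix.vecCons]

/-- The antiderivation rule `ι(X)(a ∧ β) = a(X)β - a ∧ ι(X)β`: either `X` is the vector singled out,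
or it stays first in the remaining tuple and the sign shifts by one. -/
theorem alternize_cons (g : V → (Fin (k + 1) → V) → ℝ) (X : V) (v : Fin (k + 1) → V) :
    alternize g (Matrix.vecCons X v) =
      g X v - alternize (fun u z => g u (Matrix.vecCons X z)) v := by
  rw [alternize, Fin.sum_univ_succ]
  simp only [Matrix.vecCons, Fin.val_zero, pow_zero, one_mul, Fin.cons_zero, Fin.removeNth_zero,
    Fin.tail_cons, Fin.val_succ, pow_succ, Fin.cons_succ, alternize, sub_eq_add_neg,
    ← Finset.sum_neg_distrib]
  congr 1
  refine Finset.sum_congr rfl fun i _ => ?_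
  rw [show (i.succ.removeNth (Fin.cons X v : Fin (k + 1 + 1) → V) : Fin (k + 1) → V) =
    Fin.cons X (i.removeNth v) from by
      ext j; cases j using Fin.cases <;> simp [Fin.removeNth_apply]]
  ring

/-- Each unordered pair of positions is removed in both orders, with opposite signs. Grouping the
two terms makes the antisymmetry in the first two arguments of `g` visible. -/
theorem alternize_alternize_apply (g : V → V → (Fin k → V) → ℝ) (v : Fin (k + 2) → V) :
    alternize (fun u => alternize (g u)) v =
      ∑ i : Fin (k + 1), ∑ j ≥ i, (-1 : ℝ) ^ (i + j : ℕ) *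
        (g (v i.castSucc) (v j.succ) (j.removeNth <| i.castSucc.removeNth v) -
          g (v j.succ) (v i.castSucc) (j.removeNth <| i.castSucc.removeNth v)) := by
  simp only [alternize, Finset.mul_sum, Fin.sum_sum_eq_sum_triangle_add, Fin.val_castSucc,
    Fin.val_succ]
  refine Fintype.sum_congr _ _ fun i => Finset.sum_congr rfl fun j hj => ?_
  rw [Finset.mem_Ici] at hj
  have H₁ : i.castSucc.removeNth v j = v j.succ := by
    simp [Fin.removeNth_apply, Fin.succAbove_of_le_castSucc, hj]
  have H₂ : j.succ.removeNth v i = v i.castSucc := by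
    simp [Fin.removeNth_apply, Fin.succAbove_of_castSucc_lt, hj]
  have H₃ : i.removeNth (j.succ.removeNth v) = j.removeNth (i.castSucc.removeNth v) := by
    rw [Fin.removeNth_removeNth_eq_swap]
    simp [Fin.predAbove, hj, Fin.succAbove]
  rw [H₁, H₂, H₃]
  ring

theorem alternize_swap (g : V → V → (Fin k → V) → ℝ) (v : Fin (k + 2) → V) :
    alternize (fun u => alternize (g u)) v =
      -alternize (fun u => alternize (fun w z => g w u z)) v := by
  simp only [alternize_alternize_apply, ← Finset.sum_neg_distrib]
  refine Finset.sum_congr rfl fun i _ => Finset.sum_congr rfl fun j _ => ?_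
  ring

/-- Count the signed sum of `alternize g (v ∘ σ)` twice. By `hg` it is `(k+1)!` copies of `alternize
g v`; expanding `alternize` instead, all `k+1` positions contribute the same permutation sum. -/
theorem sum_perm_eq_alternize (g : V → (Fin k → V) → ℝ)
    (hg : ∀ (σ : Equiv.Perm (Fin (k + 1))) (v : Fin (k + 1) → V),
      alternize g (v ∘ σ) = ((Equiv.Perm.sign σ : ℤ) : ℝ) * alternize g v)
    (v : Fin (k + 1) → V) :
    ∑ σ : Equiv.Perm (Fin (k + 1)), ((Equiv.Perm.sign σ : ℤ) : ℝ) *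
      g (v (σ 0)) (fun i => v (σ i.succ)) = k.factorial * alternize g v := by
  have hsq (σ : Equiv.Perm (Fin (k + 1))) :
      ((Equiv.Perm.sign σ : ℤ) : ℝ) * ((Equiv.Perm.sign σ : ℤ) : ℝ) = 1 := by
    rcases Int.units_eq_one_or (Equiv.Perm.sign σ) with h | h <;> simp [h]
  have h1 : ∑ σ : Equiv.Perm (Fin (k + 1)), ((Equiv.Perm.sign σ : ℤ) : ℝ) *
      alternize g (v ∘ σ) = (k + 1).factorial * alternize g v := by
    simp only [hg, ← mul_assoc, hsq]
    simp [Fintype.card_perm]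
  have h2 : ∑ σ : Equiv.Perm (Fin (k + 1)), ((Equiv.Perm.sign σ : ℤ) : ℝ) *
      alternize g (v ∘ σ) = (k + 1 : ℝ) * ∑ σ : Equiv.Perm (Fin (k + 1)),
        ((Equiv.Perm.sign σ : ℤ) : ℝ) * g (v (σ 0)) (fun i => v (σ i.succ)) := by
    simp only [alternize, Finset.mul_sum]
    rw [Finset.sum_comm]
    have h3 (p : Fin (k + 1)) : ∑ σ : Equiv.Perm (Fin (k + 1)),
        ((Equiv.Perm.sign σ : ℤ) : ℝ) * ((-1) ^ (p : ℕ) *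
          g ((v ∘ σ) p) (p.removeNth (v ∘ σ))) = ∑ σ : Equiv.Perm (Fin (k + 1)),
        ((Equiv.Perm.sign σ : ℤ) : ℝ) * g (v (σ 0)) (fun i => v (σ i.succ)) := by
      -- This cycle sends `0` to `p`, keeps the other indices in order, and has sign `(-1)^p`.
      refine Fintype.sum_equiv (Equiv.mulRight p.cycleRange.symm) _ _ fun σ => ?_
      have h5 : (v ∘ σ) p = v (σ (p.cycleRange.symm 0)) := by simp
      have h6 : p.removeNth (v ∘ σ) = fun i => v (σ (p.cycleRange.symm i.succ)) := by
        ext i; simp [Fin.removeNth_apply]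
      rw [h5, h6]
      have h7 : ((Equiv.Perm.sign p.cycleRange.symm : ℤ) : ℝ) = (-1) ^ (p : ℕ) := by
        simp [Equiv.Perm.sign_symm, Fin.sign_cycleRange]
      simp only [Equiv.coe_mulRight, Equiv.Perm.sign_mul, Units.val_mul, Int.cast_mul, h7,
        Equiv.Perm.mul_apply]
      ring
    rw [Finset.sum_congr rfl fun p _ => h3 p]
    simp [Finset.mul_sum]
  have h3 := h2.symm.trans h1
  rw [Nat.factorial_succ] at h3
  push_cast at h3
  have hk : (k + 1 : ℝ) ≠ 0 := by positivity
  exact mul_left_cancel₀ hk (by rw [h3]; ring)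

end Antisymmetrisation

/-! ### Wedge products with 1-forms and 2-forms as antisymmetrisations -/

section WedgeFormulas

variable {V : Type*} [AddCommGroup V] [Module ℝ V]

theorem AlternatingMap.alternatizeUncurryFin_eq_alternize {k : ℕ} (f : V →ₗ[ℝ] V [⋀^Fin k]→ₗ[ℝ] ℝ)
    (v : Fin (k + 1) → V) :
    alternatizeUncurryFin f v = alternize (fun u z => f u z) v := by
  simp [AlternatingMap.alternatizeUncurryFin_apply, alternize, zsmul_eq_mul]

theorem alternize_comp_perm {k : ℕ} (f : V →ₗ[ℝ] V [⋀^Fin k]→ₗ[ℝ] ℝ)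
    (σ : Equiv.Perm (Fin (k + 1))) (v : Fin (k + 1) → V) :
    alternize (fun u z => f u z) (v ∘ σ) =
      ((Equiv.Perm.sign σ : ℤ) : ℝ) * alternize (fun u z => f u z) v := by
  simp only [← AlternatingMap.alternatizeUncurryFin_eq_alternize, AlternatingMap.map_perm,
    Units.smul_def, zsmul_eq_mul]

variable [TopologicalSpace V]

/-- The wedge product with a `1`-form on the left. -/
theorem wedge_one_left_apply {k r : ℕ} (h : 1 + k = r) (h' : r = k + 1) (a : V [⋀^Fin 1]→L[ℝ] ℝ)
    (β : V [⋀^Fin k]→L[ℝ] ℝ) (v : Fin r → V) :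
    wedge h a β v = alternize (fun u z => a ![u] * β z) (v ∘ Fin.cast h'.symm) := by
  subst h'
  let f : V →ₗ[ℝ] V [⋀^Fin k]→ₗ[ℝ] ℝ :=
    LinearMap.smulRight
      (((AlternatingMap.ofSubsingleton ℝ V ℝ (0 : Fin 1)).symm a.toAlternatingMap)) β.toAlternatingMap
  have hf (u : V) (z : Fin k → V) : f u z = a ![u] * β z := by
    simp only [f, LinearMap.smulRight_apply, AlternatingMap.smul_apply, smul_eq_mul]
    congr 1
    change a _ = a _
    congr 1
    ext i; fin_cases i; rfl
  have key := sum_perm_eq_alternize (fun u z => f u z) (alternize_comp_perm f) v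
  simp only [hf] at key
  rw [wedge_apply]
  have hk : (k.factorial : ℝ) ≠ 0 := by positivity
  simp only [Nat.factorial_one, Nat.cast_one, one_mul]
  rw [inv_mul_eq_iff_eq_mul₀ hk]
  refine Eq.trans ?_ key
  refine Finset.sum_congr rfl fun σ _ => ?_
  congr 2
  · congr 1
    ext i
    fin_cases i
    rfl
  · congr 1
    ext i
    congr 2
    ext
    simp

theorem pair_add_left (b : V [⋀^Fin 2]→L[ℝ] ℝ) (u u' w : V) :
    b ![u + u', w] = b ![u, w] + b ![u', w] :=
  b.toMultilinearMap.cons_add ![w] u u'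

theorem pair_smul_left (b : V [⋀^Fin 2]→L[ℝ] ℝ) (c : ℝ) (u w : V) :
    b ![c • u, w] = c * b ![u, w] :=
  b.toMultilinearMap.cons_smul ![w] c u

theorem pair_swap (b : V [⋀^Fin 2]→L[ℝ] ℝ) (u w : V) : b ![u, w] = -b ![w, u] := by
  have h := b.toAlternatingMap.map_swap ![w, u] (i := 0) (j := 1) (by decide)
  have h' : (![w, u] : Fin 2 → V) ∘ Equiv.swap (0 : Fin 2) 1 = ![u, w] := by
    ext i; fin_cases i <;> simp
  rw [h'] at h
  exact h

theorem pair_add_right (b : V [⋀^Fin 2]→L[ℝ] ℝ) (u w w' : V) :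
    b ![u, w + w'] = b ![u, w] + b ![u, w'] := by
  rw [pair_swap, pair_add_left, pair_swap b u w, pair_swap b u w']
  ring

theorem pair_smul_right (b : V [⋀^Fin 2]→L[ℝ] ℝ) (c : ℝ) (u w : V) :
    b ![u, c • w] = c * b ![u, w] := by
  rw [pair_swap, pair_smul_left, pair_swap b u w]
  ring

/-- The wedge product with a `2`-form on the right. -/
theorem wedge_two_right_apply {k : ℕ} (h : k + 2 = k + 1 + 1) (β : V [⋀^Fin k]→L[ℝ] ℝ)
    (b : V [⋀^Fin 2]→L[ℝ] ℝ) (v : Fin (k + 1 + 1) → V) :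
    wedge h β b v =
      2⁻¹ * alternize (fun u => alternize (fun w z => b ![u, w] * β z)) v := by
  let f₂ : V →ₗ[ℝ] V →ₗ[ℝ] V [⋀^Fin k]→ₗ[ℝ] ℝ :=
    LinearMap.mk₂ ℝ (fun u w => b ![u, w] • β.toAlternatingMap)
      (fun u u' w => by rw [← add_smul, pair_add_left])
      (fun c u w => by rw [smul_smul, pair_smul_left])
      (fun u w w' => by rw [← add_smul, pair_add_right])
      (fun c u w => by rw [smul_smul, pair_smul_right])
  have hf₂ (u w : V) (z : Fin k → V) : f₂ u w z = b ![u, w] * β z := rfl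
  let f : V →ₗ[ℝ] V [⋀^Fin (k + 1)]→ₗ[ℝ] ℝ := AlternatingMap.alternatizeUncurryFinLM ∘ₗ f₂
  have hf (u : V) (z : Fin (k + 1) → V) :
      f u z = alternize (fun w z => b ![u, w] * β z) z := by
    simp only [f, LinearMap.comp_apply, AlternatingMap.alternatizeUncurryFinLM_apply,
      AlternatingMap.alternatizeUncurryFin_eq_alternize, hf₂]
  have key := sum_perm_eq_alternize (fun u z => f u z) (alternize_comp_perm f) v
  simp only [hf] at key
  -- The same position count for the inner antisymmetrisation, now using permutations that fix `0`
  -- and act as a cycle on the successors. The resulting factor `k+1` turns `(k+1)!` into the `k!`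
  -- of the wedge normalisation.
  have hstep : ∑ σ : Equiv.Perm (Fin (k + 1 + 1)), ((Equiv.Perm.sign σ : ℤ) : ℝ) *
      alternize (fun w z => b ![v (σ 0), w] * β z) (fun i => v (σ i.succ)) =
      (k + 1 : ℝ) * ∑ σ : Equiv.Perm (Fin (k + 1 + 1)), ((Equiv.Perm.sign σ : ℤ) : ℝ) *
        (b ![v (σ 0), v (σ 1)] * β (fun i => v (σ i.succ.succ))) := by
    simp only [alternize, Finset.mul_sum]
    rw [Finset.sum_comm]
    have h3 (p : Fin (k + 1)) : ∑ σ : Equiv.Perm (Fin (k + 1 + 1)),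
        ((Equiv.Perm.sign σ : ℤ) : ℝ) * ((-1) ^ (p : ℕ) *
          (b ![v (σ 0), v (σ p.succ)] * β (p.removeNth fun i => v (σ i.succ)))) =
        ∑ σ : Equiv.Perm (Fin (k + 1 + 1)), ((Equiv.Perm.sign σ : ℤ) : ℝ) *
          (b ![v (σ 0), v (σ 1)] * β (fun i => v (σ i.succ.succ))) := by
      refine Fintype.sum_equiv
        (Equiv.mulRight (Equiv.Perm.decomposeFin.symm (0, p.cycleRange.symm))) _ _ fun σ => ?_
      have h7 : ((Equiv.Perm.sign
          (Equiv.Perm.decomposeFin.symm (0, p.cycleRange.symm)) : ℤ) : ℝ) = (-1) ^ (p : ℕ) := by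
        simp [Equiv.Perm.decomposeFin.symm_sign, Equiv.Perm.sign_symm, Fin.sign_cycleRange]
      have h8 (i : Fin (k + 1)) :
          Equiv.Perm.decomposeFin.symm (0, p.cycleRange.symm) i.succ =
            (p.cycleRange.symm i).succ := by
        simp [Equiv.Perm.decomposeFin_symm_apply_succ]
      have h9 : Equiv.Perm.decomposeFin.symm (0, p.cycleRange.symm) 1 = p.succ := by
        rw [← Fin.succ_zero_eq_one, h8]; simp
      have h10 : (p.removeNth fun i => v (σ i.succ)) = fun i : Fin k =>
          v (σ (Equiv.Perm.decomposeFin.symm (0, p.cycleRange.symm) i.succ.succ)) := by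
        ext i; simp only [h8]; simp [Fin.removeNth_apply]
      rw [h10]
      simp only [Equiv.coe_mulRight, Equiv.Perm.sign_mul, Units.val_mul, Int.cast_mul, h7,
        Equiv.Perm.mul_apply, h9, Equiv.Perm.decomposeFin_symm_apply_zero]
      ring
    rw [Finset.sum_congr rfl fun p _ => h3 p]
    simp [Finset.mul_sum]
  rw [hstep, Nat.factorial_succ] at key
  push_cast at key
  have hk : (k + 1 : ℝ) ≠ 0 := by positivity
  rw [mul_assoc] at key
  have key' := mul_left_cancel₀ hk key
  -- The wedge feeds `b` the last two vectors, `key'` the first two. Two rotations exchange the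
  -- conventions, and a square of a permutation is even.
  have hrot : ∑ σ : Equiv.Perm (Fin (k + 1 + 1)), ((Equiv.Perm.sign σ : ℤ) : ℝ) *
        (b ![v (σ 0), v (σ 1)] * β (fun i => v (σ i.succ.succ))) =
      ∑ σ : Equiv.Perm (Fin (k + 1 + 1)), ((Equiv.Perm.sign σ : ℤ) : ℝ) *
        (β (fun i => v (σ (Fin.cast h (Fin.castAdd 2 i)))) *
          b (fun j => v (σ (Fin.cast h (Fin.natAdd k j))))) := by
    refine Fintype.sum_equiv (Equiv.mulRight (finRotate _ * finRotate _)) _ _ fun σ => ?_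
    have hs : ((Equiv.Perm.sign (finRotate (k + 1 + 1) * finRotate (k + 1 + 1)) : ℤ) : ℝ) = 1 := by
      rcases Int.units_eq_one_or (Equiv.Perm.sign (finRotate (k + 1 + 1))) with h | h <;>
        rw [Equiv.Perm.sign_mul, h] <;> simp
    have hl (i : Fin k) : finRotate (k + 1 + 1)
        (finRotate (k + 1 + 1) (Fin.cast h (Fin.castAdd 2 i))) = i.succ.succ := by
      have hi : Fin.cast h (Fin.castAdd 2 i) = ⟨i, by omega⟩ := rfl
      rw [hi, finRotate_of_lt (k := i) (by omega), finRotate_of_lt (by omega)]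
      rfl
    have hr (j : Fin 2) : finRotate (k + 1 + 1)
        (finRotate (k + 1 + 1) (Fin.cast h (Fin.natAdd k j))) = ⟨j, by omega⟩ := by
      have hj : Fin.cast h (Fin.natAdd k j) = ⟨k + j, by omega⟩ := rfl
      rw [hj]
      fin_cases j
      · change finRotate (k + 1 + 1) (finRotate (k + 1 + 1) ⟨k, _⟩) = _
        rw [finRotate_of_lt (k := k) (by omega), finRotate_last']
      · change finRotate (k + 1 + 1) (finRotate (k + 1 + 1) ⟨k + 1, _⟩) = _
        rw [finRotate_last', finRotate_of_lt (by omega)]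
    simp only [Equiv.coe_mulRight, Equiv.Perm.sign_mul σ, Units.val_mul, Int.cast_mul,
      Equiv.Perm.mul_apply, hl, hr]
    push_cast [Equiv.Perm.sign_mul] at hs ⊢
    rw [hs, mul_one, mul_comm (β _)]
    congr 3
    ext j
    fin_cases j <;> rfl
  rw [wedge_apply, ← hrot, key']
  have hk' : (k.factorial : ℝ) ≠ 0 := by positivity
  simp only [Nat.factorial_two]
  push_cast
  field_simp

end WedgeFormulas

/-! ### Powers of a 2-form and their interior products -/

section PowerFormulas

variable {V : Type*} [AddCommGroup V] [Module ℝ V] [TopologicalSpace V]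

theorem wedgePow_succ_apply (b : V [⋀^Fin 2]→L[ℝ] ℝ) (m : ℕ) (v : Fin (2 * m + 1 + 1) → V) :
    wedgePow b (m + 1) v =
      2⁻¹ * alternize (fun u => alternize (fun w z => b ![u, w] * wedgePow b m z)) v :=
  wedge_two_right_apply _ _ _ v

/-- The interior product of a vector with a power of a `2`-form. -/
theorem wedgePow_succ_cons (b : V [⋀^Fin 2]→L[ℝ] ℝ) (X : V) (m : ℕ) (v : Fin (2 * m + 1) → V) :
    wedgePow b (m + 1) (Matrix.vecCons X v : Fin (2 * m + 1 + 1) → V) =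
      (m + 1) * alternize (fun w z => b ![X, w] * wedgePow b m z) v := by
  induction m with
  | zero =>
    rw [wedgePow_succ_apply, alternize_cons]
    simp only [alternize_cons_zero, pair_swap b _ X, neg_mul]
    rw [alternize_neg]
    norm_num
    ring
  | succ m ih =>
    rw [wedgePow_succ_apply, alternize_cons]
    -- Having missed the first slot of `b`, the vector `X` lands either in its second slot, with a
    -- sign from `pair_swap`, or inside the power, where the induction hypothesis applies. The final
    -- count is `2⁻¹ (1 + 1 + 2(m+1)) = m+2`.
    have h1 (u : V) (z : Fin (2 * (m + 1)) → V) :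
        alternize (fun w z => b ![u, w] * wedgePow b (m + 1) z) (Matrix.vecCons X z) =
          -(b ![X, u] * wedgePow b (m + 1) z) - (m + 1) * alternize (k := 2 * m + 1) (fun w =>
            alternize (fun x y => b ![u, w] * (b ![X, x] * wedgePow b m y))) z := by
      refine (alternize_cons (k := 2 * m + 1) _ X z).trans ?_
      rw [pair_swap b u X, neg_mul, ← alternize_const_mul]
      congr 1
      refine alternize_congr (fun w z => ?_) _
      rw [ih, alternize_const_mul]
      ring
    simp only [h1]
    rw [alternize_sub, alternize_neg, alternize_const_mul]
    -- Moving `ι(X)b` to the front past `u` and `w` takes two swaps, hence no sign; what remains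
    -- inside is `2 b^(m+1)`.
    have h2 : alternize (fun u => alternize (k := 2 * m + 1) (fun w =>
            alternize (fun x y => b ![u, w] * (b ![X, x] * wedgePow b m y)))) v =
        2 * alternize (fun x z => b ![X, x] * wedgePow b (m + 1) z) v := by
      have h3 (u : V) (z : Fin (2 * m + 1 + 1) → V) : alternize (k := 2 * m + 1) (fun w =>
            alternize (fun x y => b ![u, w] * (b ![X, x] * wedgePow b m y))) z =
          -alternize (k := 2 * m + 1) (fun x =>
            alternize (fun w y => b ![u, w] * (b ![X, x] * wedgePow b m y))) z :=
        alternize_swap _ z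
      rw [alternize_congr h3, alternize_neg]
      rw [alternize_swap (k := 2 * m + 1) (fun u x =>
            alternize (fun w y => b ![u, w] * (b ![X, x] * wedgePow b m y))), neg_neg,
        ← alternize_const_mul]
      refine alternize_congr (fun x z => ?_) _
      have h4 (c d : ℝ) : 2 * (c * (2⁻¹ * d)) = c * d := by ring
      rw [wedgePow_succ_apply, h4, ← alternize_const_mul]
      refine alternize_congr (fun u z => ?_) _
      rw [← alternize_const_mul]
      refine alternize_congr (fun w z => ?_) _
      ring
    rw [h2]
    push_cast
    ring

end PowerFormulas

/-! ### Exterior derivatives and smoothness of forms on a vector space -/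

section Calculus

variable {E : Type*} [NormedAddCommGroup E] [NormedSpace ℝ E]

theorem extDeriv_eq_alternize {k : ℕ} (η : E → E [⋀^Fin k]→L[ℝ] ℝ) (x : E) (v : Fin (k + 1) → E) :
    extDeriv η x v = alternize (fun u z => fderiv ℝ η x u z) v := by
  simp [extDeriv, ContinuousAlternatingMap.alternatizeUncurryFin_apply, alternize, zsmul_eq_mul]

theorem hasFDerivAt_alternating_apply {k : ℕ} {η : E → E [⋀^Fin k]→L[ℝ] ℝ} {x : E}
    (h : DifferentiableAt ℝ η x) (z : Fin k → E) :
    HasFDerivAt (fun y => η y z)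
      ((ContinuousAlternatingMap.apply ℝ E ℝ z).comp (fderiv ℝ η x)) x :=
  (ContinuousAlternatingMap.apply ℝ E ℝ z).hasFDerivAt.comp x h.hasFDerivAt

theorem fderiv_alternating_apply {k : ℕ} {η : E → E [⋀^Fin k]→L[ℝ] ℝ} {x : E}
    (h : DifferentiableAt ℝ η x) (z : Fin k → E) (e : E) :
    fderiv ℝ (fun y => η y z) x e = fderiv ℝ η x e z := by
  rw [(hasFDerivAt_alternating_apply h z).fderiv]
  rfl

theorem differentiableAt_alternize {k : ℕ} {V : Type*} {g : E → V → (Fin k → V) → ℝ} {x : E}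
    (hg : ∀ u z, DifferentiableAt ℝ (fun y => g y u z) x) (v : Fin (k + 1) → V) :
    DifferentiableAt ℝ (fun y => alternize (g y) v) x := by
  unfold alternize
  fun_prop

theorem fderiv_alternize {k : ℕ} {V : Type*} {g : E → V → (Fin k → V) → ℝ} {x : E}
    (hg : ∀ u z, DifferentiableAt ℝ (fun y => g y u z) x) (v : Fin (k + 1) → V) (e : E) :
    fderiv ℝ (fun y => alternize (g y) v) x e =
      alternize (fun u z => fderiv ℝ (fun y => g y u z) x e) v := by
  unfold alternize
  rw [fderiv_fun_sum fun i _ => by fun_prop]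
  simp only [sum_apply]
  refine Finset.sum_congr rfl fun i _ => ?_
  rw [fderiv_const_mul (hg _ _)]
  rfl

/-- A form-valued function on a finite dimensional space is smooth as soon as its evaluations
are. -/
theorem contDiffOn_of_alternating_apply [FiniteDimensional ℝ E] {F : Type*} [NormedAddCommGroup F]
    [NormedSpace ℝ F] {N : WithTop ℕ∞} {k : ℕ} {η : F → E [⋀^Fin k]→L[ℝ] ℝ} {s : Set F}
    (h : ∀ v : Fin k → E, ContDiffOn ℝ N (fun y => η y v) s) : ContDiffOn ℝ N η s := by
  induction k with
  | zero =>
    have : η = fun y => ContinuousAlternatingMap.constOfIsEmptyLIE ℝ E ℝ (Fin 0) (η y ![]) := by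
      ext y v
      simp [Subsingleton.elim v ![]]
    rw [this]
    exact (ContinuousAlternatingMap.constOfIsEmptyLIE ℝ E ℝ (Fin 0)).contDiff.comp_contDiffOn (h _)
  | succ k ih =>
    have h1 : ContDiffOn ℝ N (fun y => (η y).curryLeft) s :=
      contDiffOn_clm_apply.2 fun u => ih fun v => h (Matrix.vecCons u v)
    -- Alternatising the curried form returns `k+1` times the form, so `η` is recovered linearly
    -- from a function covered by the induction hypothesis.
    have h2 : η = fun y => ((k : ℝ) + 1)⁻¹ •
        ContinuousAlternatingMap.alternatizeUncurryFinCLM ℝ E ℝ (η y).curryLeft := by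
      ext y v
      have hk : (k + 1 : ℝ) ≠ 0 := by positivity
      simp [hk]
    rw [h2]
    have h3 : ContDiffOn ℝ N (fun y =>
        ContinuousAlternatingMap.alternatizeUncurryFinCLM ℝ E ℝ (η y).curryLeft) s :=
      ContDiff.comp_contDiffOn (g := ContinuousAlternatingMap.alternatizeUncurryFinCLM ℝ E ℝ (n := k))
        (ContinuousLinearMap.contDiff _) h1
    exact h3.const_smul (((k : ℝ) + 1)⁻¹)

theorem contDiffOn_alternating_apply {F : Type*} [NormedAddCommGroup F]
    [NormedSpace ℝ F] {N : WithTop ℕ∞} {k : ℕ} {η : F → E [⋀^Fin k]→L[ℝ] ℝ} {s : Set F}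
    (h : ContDiffOn ℝ N η s) (v : Fin k → E) : ContDiffOn ℝ N (fun y => η y v) s :=
  (ContinuousAlternatingMap.apply ℝ E ℝ v).contDiff.comp_contDiffOn h

theorem contDiffOn_wedge [FiniteDimensional ℝ E] {N : WithTop ℕ∞} {p q r : ℕ} (hr : p + q = r)
    {a : E → E [⋀^Fin p]→L[ℝ] ℝ} {b : E → E [⋀^Fin q]→L[ℝ] ℝ} {s : Set E}
    (ha : ContDiffOn ℝ N a s) (hb : ContDiffOn ℝ N b s) :
    ContDiffOn ℝ N (fun y => wedge hr (a y) (b y)) s := by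
  refine contDiffOn_of_alternating_apply fun v => ?_
  simp only [wedge_apply]
  exact contDiffOn_const.mul (ContDiffOn.sum fun σ _ => contDiffOn_const.mul
    ((contDiffOn_alternating_apply ha _).mul (contDiffOn_alternating_apply hb _)))

theorem contDiffOn_wedgePow [FiniteDimensional ℝ E] {N : WithTop ℕ∞}
    {b : E → E [⋀^Fin 2]→L[ℝ] ℝ} {s : Set E} (hb : ContDiffOn ℝ N b s) (m : ℕ) :
    ContDiffOn ℝ N (fun y => wedgePow (b y) m) s := by
  induction m with
  | zero => exact contDiffOn_const
  | succ m ih => exact contDiffOn_wedge _ ih hb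

theorem contDiffOn_extDeriv {k : ℕ} {η : E → E [⋀^Fin k]→L[ℝ] ℝ} {s : Set E} (hs : IsOpen s)
    (h : ContDiffOn ℝ ∞ η s) : ContDiffOn ℝ ∞ (extDeriv η) s := by
  have h' : ContDiffOn ℝ ∞ (fderiv ℝ η) s := h.fderiv_of_isOpen hs (by simp)
  exact (ContinuousAlternatingMap.alternatizeUncurryFinCLM ℝ E ℝ (n := k)).contDiff.comp_contDiffOn h'

theorem differentiableAt_wedgePow [FiniteDimensional ℝ E] {b : E → E [⋀^Fin 2]→L[ℝ] ℝ} {x : E}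
    {s : Set E} (hs : IsOpen s) (hx : x ∈ s) (hb : ContDiffOn ℝ ∞ b s) (m : ℕ) :
    DifferentiableAt ℝ (fun y => wedgePow (b y) m) x :=
  ((contDiffOn_wedgePow hb m).contDiffAt (hs.mem_nhds hx)).differentiableAt (by simp)

theorem differentiableAt_alternating_apply {k : ℕ} {η : E → E [⋀^Fin k]→L[ℝ] ℝ} {x : E}
    (h : DifferentiableAt ℝ η x) (z : Fin k → E) : DifferentiableAt ℝ (fun y => η y z) x :=
  (hasFDerivAt_alternating_apply h z).differentiableAt

theorem fderiv_mul_apply' {f g : E → ℝ} {x : E} (hf : DifferentiableAt ℝ f x)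
    (hg : DifferentiableAt ℝ g x) (e : E) :
    fderiv ℝ (fun y => f y * g y) x e = fderiv ℝ f x e * g x + f x * fderiv ℝ g x e := by
  rw [fderiv_fun_mul hf hg]
  simp [mul_comm, add_comm]

theorem extDeriv_two_form_apply {b : E → E [⋀^Fin 2]→L[ℝ] ℝ} (x u v w : E) :
    extDeriv b x ![u, v, w] =
      fderiv ℝ b x u ![v, w] - fderiv ℝ b x v ![u, w] + fderiv ℝ b x w ![u, v] := by
  rw [extDeriv_eq_alternize]
  have h1 : Fin.removeNth 1 ![u, v, w] = ![u, w] := by ext i; fin_cases i <;> rfl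
  have h2 : Fin.removeNth 2 ![u, v, w] = ![u, v] := by ext i; fin_cases i <;> rfl
  simp [alternize, Fin.sum_univ_three, h1, h2, sub_eq_add_neg]

theorem extDeriv_one_form_apply {a : E → E [⋀^Fin 1]→L[ℝ] ℝ} (x u v : E) :
    extDeriv a x ![u, v] = fderiv ℝ a x u ![v] - fderiv ℝ a x v ![u] := by
  rw [extDeriv_eq_alternize]
  have h1 : Fin.removeNth 1 ![u, v] = ![u] := by ext i; fin_cases i; rfl
  simp [alternize, Fin.sum_univ_two, h1, sub_eq_add_neg]

/-- The powers of a closed `2`-form are closed. -/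
theorem extDeriv_wedgePow [FiniteDimensional ℝ E] {b : E → E [⋀^Fin 2]→L[ℝ] ℝ} {x : E}
    {s : Set E} (hs : IsOpen s) (hx : x ∈ s) (hb : ContDiffOn ℝ ∞ b s) (hd : extDeriv b x = 0)
    (m : ℕ) : extDeriv (fun y => wedgePow (b y) m) x = 0 := by
  have hb' : DifferentiableAt ℝ b x :=
    (hb.contDiffAt (hs.mem_nhds hx)).differentiableAt (by simp)
  induction m with
  | zero =>
    ext v
    simp only [extDeriv_eq_alternize, wedgePow, fderiv_fun_const, Pi.zero_apply, zero_apply]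
    exact alternize_zero v
  | succ m ih =>
    have hP := differentiableAt_wedgePow hs hx hb m
    have hP' (z) := differentiableAt_alternating_apply hP z
    have hbz (u w) := differentiableAt_alternating_apply hb' ![u, w]
    ext v
    change Fin (2 * m + 1 + 1 + 1) → E at v
    refine (extDeriv_eq_alternize (k := 2 * m + 1 + 1) _ x v).trans ?_
    have h1 (u : E) (z : Fin (2 * m + 1 + 1) → E) :
        fderiv ℝ (fun y => wedgePow (b y) (m + 1)) x u z =
          2⁻¹ * (alternize (fun p => alternize (fun q y =>
            fderiv ℝ b x u ![p, q] * wedgePow (b x) m y)) z +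
          alternize (fun p => alternize (fun q y =>
            b x ![p, q] * fderiv ℝ (fun y => wedgePow (b y) m) x u y)) z) := by
      refine (fderiv_alternating_apply (k := 2 * m + 1 + 1)
        (differentiableAt_wedgePow hs hx hb (m + 1)) z u).symm.trans ?_
      rw [show (fun y => wedgePow (b y) (m + 1) z) = fun y => 2⁻¹ * alternize (fun u =>
        alternize (fun w z => b y ![u, w] * wedgePow (b y) m z)) z from
        funext fun y => wedgePow_succ_apply _ _ _]
      have hd₁ (p q : E) (y : Fin (2 * m) → E) :
          DifferentiableAt ℝ (fun t => b t ![p, q] * wedgePow (b t) m y) x := (hbz _ _).mul (hP' _)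
      rw [fderiv_const_mul (differentiableAt_alternize (fun _ _ => differentiableAt_alternize
        (fun _ _ => hd₁ _ _ _) _) _)]
      rw [smul_apply, smul_eq_mul]
      rw [fderiv_alternize (fun _ _ => differentiableAt_alternize
        (fun _ _ => hd₁ _ _ _) _), ← alternize_add]
      congr 1
      refine alternize_congr (fun p y => ?_) _
      rw [fderiv_alternize (fun _ _ => hd₁ _ _ _), ← alternize_add]
      refine alternize_congr (fun q y => ?_) _
      rw [fderiv_mul_apply' (hbz _ _) (hP' _), fderiv_alternating_apply hb',
        fderiv_alternating_apply hP]
    refine (alternize_congr h1 v).trans ?_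
    rw [alternize_const_mul, alternize_add]
    -- Swapping the direction `u` past `p` and `q` brings it next to the power, where it forms
    -- `d(b^m) = 0`.
    have h2 : alternize (fun u => alternize (fun p => alternize (fun q y =>
            b x ![p, q] * fderiv ℝ (fun y => wedgePow (b y) m) x u y))) v = 0 := by
      rw [alternize_swap]
      rw [alternize_congr fun p z => alternize_swap _ _, alternize_neg]
      have h3 (p q : E) (z : Fin (2 * m + 1) → E) : alternize (fun u y =>
          b x ![p, q] * fderiv ℝ (fun y => wedgePow (b y) m) x u y) z = 0 := by
        rw [alternize_const_mul, ← extDeriv_eq_alternize, ih]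
        simp
      have h3' (p q : E) : alternize (fun u y =>
          b x ![p, q] * fderiv ℝ (fun y => wedgePow (b y) m) x u y) = fun _ => 0 := funext (h3 p q)
      simp only [h3', alternize_fun_zero, neg_zero]
    let S (g : E → E → E → ℝ) : ℝ := alternize (fun u => alternize (fun p => alternize (fun q y =>
            g u p q * wedgePow (b x) m y))) v
    have hS1 (g : E → E → E → ℝ) : S g = -S fun u p q => g p u q := alternize_swap _ _
    have hS2 (g : E → E → E → ℝ) : S g = -S fun u p q => g u q p := by
      simp only [S]
      rw [← alternize_neg]
      exact alternize_congr (fun u z => alternize_swap _ _) _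
    have hS3 (g g' : E → E → E → ℝ) : S (fun u p q => g u p q + g' u p q) = S g + S g' := by
      simp only [S, add_mul, alternize_fun_add]
    -- Under `S` the three signed terms of `db` have equal value, so `db = 0` says that three times
    -- this value is zero.
    have h4 : S (fun u p q => fderiv ℝ b x u ![p, q]) = 0 := by
      have h5 : S (fun u p q => fderiv ℝ b x u ![p, q] + -fderiv ℝ b x p ![u, q] +
          fderiv ℝ b x q ![u, p]) = 0 := by
        have (u p q : E) : fderiv ℝ b x u ![p, q] + -fderiv ℝ b x p ![u, q] +
          fderiv ℝ b x q ![u, p] = 0 := by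
          rw [← sub_eq_add_neg, ← extDeriv_two_form_apply, hd]
          rfl
        simp only [this, S, zero_mul, alternize_fun_zero]
      rw [hS3, hS3] at h5
      have h6 := hS1 fun u p q => fderiv ℝ b x u ![p, q]
      have h7 := hS2 fun u p q => fderiv ℝ b x q ![u, p]
      have h8 := hS1 fun u p q => fderiv ℝ b x p ![u, q]
      have h9 : S (fun u p q => -fderiv ℝ b x p ![u, q]) =
          -S (fun u p q => fderiv ℝ b x p ![u, q]) := by
        simp only [S, neg_mul, alternize_fun_neg]
      linarith
    change 2⁻¹ * (S (fun u p q => fderiv ℝ b x u ![p, q]) + _) = 0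
    rw [h4, h2]
    simp

end Calculus

/-! ### The two local identities behind closedness and the flux formula -/

section Calculus

variable {E : Type*} [NormedAddCommGroup E] [NormedSpace ℝ E]

theorem extDeriv_fun_smul_apply {k : ℕ} {f : E → ℝ} {η : E → E [⋀^Fin k]→L[ℝ] ℝ} {x : E}
    (hf : DifferentiableAt ℝ f x) (hη : DifferentiableAt ℝ η x) (v : Fin (k + 1) → E) :
    extDeriv (fun y => f y • η y) x v =
      alternize (fun u z => fderiv ℝ f x u * η x z) v + f x * extDeriv η x v := by
  rw [extDeriv_eq_alternize, extDeriv_eq_alternize, ← alternize_const_mul, ← alternize_add]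
  refine alternize_congr (fun u z => ?_) _
  rw [fderiv_fun_smul hf hη]
  simp [add_comm]

/-- The Leibniz rule for the product of a `1`-form and a closed form. -/
theorem extDeriv_wedge_one_left_apply {k r : ℕ} (h : 1 + k = r) (h' : r = k + 1)
    {a : E → E [⋀^Fin 1]→L[ℝ] ℝ} {P : E → E [⋀^Fin k]→L[ℝ] ℝ} {x : E}
    (hw : DifferentiableAt ℝ (fun y => wedge h (a y) (P y)) x)
    (ha : DifferentiableAt ℝ a x) (hP : DifferentiableAt ℝ P x) (hd : extDeriv P x = 0)
    (v : Fin (k + 1 + 1) → E) :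
    extDeriv (fun y => wedge h (a y) (P y)) x (v ∘ Fin.cast (by rw [h'])) =
      alternize (fun u => alternize (fun w z => fderiv ℝ a x u ![w] * P x z)) v := by
  subst h'
  have haz (w) := differentiableAt_alternating_apply ha ![w]
  have hPz (z) := differentiableAt_alternating_apply hP z
  have hm (w : E) (z : Fin k → E) : DifferentiableAt ℝ (fun y => a y ![w] * P y z) x :=
    (haz w).mul (hPz z)
  have h1 (u : E) (z : Fin (k + 1) → E) :
      fderiv ℝ (fun y => wedge h (a y) (P y)) x u z =
        alternize (fun w z => fderiv ℝ a x u ![w] * P x z) z +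
          alternize (fun w z => a x ![w] * fderiv ℝ P x u z) z := by
    rw [← fderiv_alternating_apply hw]
    rw [show (fun y => wedge h (a y) (P y) z) = fun y =>
      alternize (fun w z => a y ![w] * P y z) z from
      funext fun y => wedge_one_left_apply _ rfl _ _ _]
    rw [fderiv_alternize fun _ _ => hm _ _, ← alternize_add]
    refine alternize_congr (fun w z => ?_) _
    rw [fderiv_mul_apply' (haz w) (hPz z), fderiv_alternating_apply ha,
      fderiv_alternating_apply hP]
  change extDeriv (fun y => wedge h (a y) (P y)) x v = _
  rw [extDeriv_eq_alternize, alternize_congr h1, alternize_add]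
  -- This is the term `a ∧ dP` up to sign.
  have h2 : alternize (fun u => alternize (fun w z => a x ![w] * fderiv ℝ P x u z)) v = 0 := by
    rw [alternize_swap]
    have h3 (w : E) : alternize (fun u z => a x ![w] * fderiv ℝ P x u z) = fun _ => 0 := by
      ext z
      rw [alternize_const_mul, ← extDeriv_eq_alternize, hd]
      simp
    simp only [h3, alternize_fun_zero, neg_zero]
  exact add_eq_left.2 h2

/-- Antisymmetrising the derivative of `a` already yields `da`: the two halves of `da(u, w)`
contribute equally, which absorbs the `2⁻¹` of `wedgePow_succ_apply`. -/
theorem alternize_fderiv_eq_wedgePow_succ {a : E → E [⋀^Fin 1]→L[ℝ] ℝ} {x : E} {m : ℕ}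
    (v : Fin (2 * m + 1 + 1) → E) :
    alternize (fun u => alternize (fun w z =>
      fderiv ℝ a x u ![w] * wedgePow (extDeriv a x) m z)) v = wedgePow (extDeriv a x) (m + 1) v := by
  rw [wedgePow_succ_apply]
  have h1 (u : E) (z : Fin (2 * m + 1) → E) :
      alternize (fun w z => extDeriv a x ![u, w] * wedgePow (extDeriv a x) m z) z =
        alternize (fun w z => fderiv ℝ a x u ![w] * wedgePow (extDeriv a x) m z) z -
          alternize (fun w z => fderiv ℝ a x w ![u] * wedgePow (extDeriv a x) m z) z := by
    rw [← alternize_sub]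
    refine alternize_congr (fun w z => ?_) _
    rw [extDeriv_one_form_apply, sub_mul]
  rw [alternize_congr h1, alternize_sub,
    alternize_swap (fun u w z => fderiv ℝ a x w ![u] * wedgePow (extDeriv a x) m z) v]
  ring

theorem extDeriv_extDeriv_of_contDiffOn {k : ℕ} {s : Set E} {x : E} {η : E → E [⋀^Fin k]→L[ℝ] ℝ} (hs : IsOpen s)
    (hx : x ∈ s) (hη : ContDiffOn ℝ ∞ η s) : extDeriv (extDeriv η) x = 0 :=
  extDeriv_extDeriv_apply (hη.contDiffAt (hs.mem_nhds hx))
    (by rw [minSmoothness_of_isRCLikeNormedField]; exact WithTop.coe_le_coe.2 le_top)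

variable [FiniteDimensional ℝ E] {s : Set E} {x : E} {a : E → E [⋀^Fin 1]→L[ℝ] ℝ} {f : E → ℝ}

/-- `d (f (da)^n) = 0` if `df = -ι(X) da`, in dimension at most `2n+1`. -/
theorem extDeriv_smul_wedgePow_eq_zero {n : ℕ} (hdim : Module.finrank ℝ E < 2 * n + 2)
    (hs : IsOpen s) (hx : x ∈ s) (ha : ContDiffOn ℝ ∞ a s) (hf : DifferentiableAt ℝ f x)
    {X : E} (hX : ∀ w, fderiv ℝ f x w = -extDeriv a x ![X, w]) :
    extDeriv (fun y => f y • wedgePow (extDeriv a y) n) x = 0 := by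
  have hb := contDiffOn_extDeriv hs ha
  have hP := differentiableAt_wedgePow hs hx hb n
  ext v
  rw [extDeriv_fun_smul_apply hf hP, extDeriv_wedgePow hs hx hb
    (extDeriv_extDeriv_of_contDiffOn hs hx ha)]
  simp only [hX, neg_mul, alternize_fun_neg]
  -- Thus `ι(X)da ∧ (da)^n` is `(n+1)⁻¹ ι(X)(da)^(n+1)`, and a form of degree `2n+2` vanishes in
  -- smaller dimension.
  have h1 := wedgePow_succ_cons (extDeriv a x) X n v
  have h2 : wedgePow (extDeriv a x) (n + 1) (Matrix.vecCons X v : Fin (2 * n + 1 + 1) → E) = 0 := by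
    refine AlternatingMap.map_linearDependent
      (wedgePow (extDeriv a x) (n + 1)).toAlternatingMap _ fun hli => ?_
    have := hli.fintype_card_le_finrank
    simp at this
    omega
  rw [h2] at h1
  have hn : (n + 1 : ℝ) ≠ 0 := by positivity
  have h3 := (mul_eq_zero.1 h1.symm).resolve_left hn
  rw [h3]
  simp

/-- The interior product of `a ∧ (da)^(m+1)` with `X` is `(m+2) f (da)^(m+1)` up to the differential
of `-(m+1) f a ∧ (da)^m`, if `f = a(X)` and `df = -ι(X) da`. -/
theorem wedge_wedgePow_cons_add_extDeriv {m : ℕ} (h : 1 + 2 * (m + 1) = 2 * (m + 1) + 1)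
    (h' : 1 + 2 * m = 2 * m + 1)
    (hs : IsOpen s) (hx : x ∈ s) (ha : ContDiffOn ℝ ∞ a s) (hf : DifferentiableAt ℝ f x)
    {X : E} (hfx : f x = a x ![X]) (hX : ∀ w, fderiv ℝ f x w = -extDeriv a x ![X, w])
    (v : Fin (2 * m + 1 + 1) → E) :
    wedge h (a x) (wedgePow (extDeriv a x) (m + 1)) (Matrix.vecCons X v) +
      (m + 1) * extDeriv (fun y => f y • wedge h' (a y) (wedgePow (extDeriv a y) m)) x v =
      (m + 2) * (f x * wedgePow (extDeriv a x) (m + 1) v) := by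
  have hb := contDiffOn_extDeriv hs ha
  have hP := differentiableAt_wedgePow hs hx hb m
  have ha' : DifferentiableAt ℝ a x :=
    (ha.contDiffAt (hs.mem_nhds hx)).differentiableAt (by simp)
  have hw : DifferentiableAt ℝ (fun y => wedge h' (a y) (wedgePow (extDeriv a y) m)) x :=
    ((contDiffOn_wedge h' ha (contDiffOn_wedgePow hb m)).contDiffAt (hs.mem_nhds hx)).differentiableAt
      (by simp)
  have h1 := extDeriv_wedge_one_left_apply h' rfl hw ha' hP
    (extDeriv_wedgePow hs hx hb (extDeriv_extDeriv_of_contDiffOn hs hx ha) m) v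
  rw [alternize_fderiv_eq_wedgePow_succ] at h1
  change extDeriv (fun y => wedge h' (a y) (wedgePow (extDeriv a y) m)) x v = _ at h1
  rw [extDeriv_fun_smul_apply hf hw, h1]
  have h2 : wedge h (a x) (wedgePow (extDeriv a x) (m + 1))
      (Matrix.vecCons X v : Fin (2 * m + 1 + 1 + 1) → E) =
      a x ![X] * wedgePow (extDeriv a x) (m + 1) v - (m + 1) * alternize (fun u =>
        alternize (fun w z => a x ![u] * (extDeriv a x ![X, w] * wedgePow (extDeriv a x) m z))) v := by
    refine (wedge_one_left_apply h rfl _ _ _).trans ?_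
    refine (alternize_cons (k := 2 * m + 1) _ X v).trans ?_
    rw [← alternize_const_mul]
    congr 1
    refine alternize_congr (fun u z => ?_) _
    rw [wedgePow_succ_cons, alternize_const_mul]
    ring
  rw [h2, alternize_swap]
  -- The term `df ∧ a ∧ (da)^m` cancels the part of the interior product in which `X` enters the
  -- power. The coefficient `m+2` is `1` from `a(X)` plus `m+1` from `f da ∧ (da)^m`.
  have h3 : alternize (fun u z => fderiv ℝ f x u *
      wedge h' (a x) (wedgePow (extDeriv a x) m) z) v = - alternize (fun w =>
        alternize (fun u z => a x ![u] * (extDeriv a x ![X, w] * wedgePow (extDeriv a x) m z))) v := by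
    rw [← alternize_neg]
    refine alternize_congr (fun u z => ?_) _
    rw [hX, neg_mul, wedge_one_left_apply h' rfl, ← alternize_const_mul]
    congr 1
    exact alternize_congr (fun _ _ => by ring) _
  rw [h3, hfx]
  ring

end Calculus

/-! ### Forms and vector fields in charts; chart independence of `d` -/

section Charts

variable {E : Type*} [NormedAddCommGroup E] [NormedSpace ℝ E]
  {M : Type*} [TopologicalSpace M] [ChartedSpace E M]

theorem DForm.inChart_chartAt {k : ℕ} (β : DForm E M k) {x₀ z : M} (hz : z ∈ (chartAt E x₀).source) :
    β.inChart x₀ (chartAt E x₀ z) = ContinuousAlternatingMap.compContinuousLinearMap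
      (β z : E [⋀^Fin k]→L[ℝ] ℝ) (chartInvDeriv x₀ (chartAt E x₀ z) : E →L[ℝ] E) := by
  -- Every tangent space is `E` by definition; forgetting the dependence on the point allows the
  -- base point to be rewritten.
  let β' : M → E [⋀^Fin k]→L[ℝ] ℝ := β
  change (β' ((chartAt E x₀).symm (chartAt E x₀ z))).compContinuousLinearMap
    (chartInvDeriv x₀ (chartAt E x₀ z) : E →L[ℝ] E) = (β' z).compContinuousLinearMap _
  rw [(chartAt E x₀).left_inv hz]

variable [IsManifold 𝓘(ℝ, E) ∞ M]

/-- The tangent space at `x` is identified with `E` by the preferred chart at `x`. Hence the chart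
differentials in the definitions of `d` and of the Lie derivative disappear at `x`. -/
theorem chartDeriv_self (x : M) : (chartDeriv x x : E →L[ℝ] E) = ContinuousLinearMap.id ℝ E := by
  have := mfderiv_extChartAt_self (I := 𝓘(ℝ, E)) (x := x)
  simpa [mfld_simps] using! this

theorem chartInvDeriv_comp_chartDeriv {x₀ z : M} (hz : z ∈ (chartAt E x₀).source) :
    ContinuousLinearMap.comp (chartInvDeriv x₀ (chartAt E x₀ z) : E →L[ℝ] E)
      (chartDeriv x₀ z : E →L[ℝ] E) = ContinuousLinearMap.id ℝ E :=
  (mdifferentiable_chart (I := 𝓘(ℝ, E)) x₀).symm_comp_deriv hz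

theorem chartInvDeriv_self (x : M) :
    (chartInvDeriv x (chartAt E x x) : E →L[ℝ] E) = ContinuousLinearMap.id ℝ E := by
  have := chartInvDeriv_comp_chartDeriv (mem_chart_source E x)
  exact ContinuousLinearMap.ext fun v =>
    (congrArg (chartInvDeriv x (chartAt E x x) : E →L[ℝ] E)
      (DFunLike.congr_fun (chartDeriv_self x) v).symm).trans (DFunLike.congr_fun this v)

theorem DForm.inChart_self {k : ℕ} (β : DForm E M k) (x : M) :
    β.inChart x (chartAt E x x) = β x := by
  rw [DForm.inChart_chartAt β (mem_chart_source E x), chartInvDeriv_self]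
  rfl

theorem VField.inChart_self (X : VField E M) (x : M) : X.inChart x (chartAt E x x) = X x := by
  let X' : M → E := X
  let D : M → E →L[ℝ] E := fun z => chartDeriv x z
  change D ((chartAt E x).symm (chartAt E x x)) (X' ((chartAt E x).symm (chartAt E x x))) = X' x
  rw [(chartAt E x).left_inv (mem_chart_source E x)]
  simp only [D, chartDeriv_self]
  rfl

theorem chartInvDeriv_inChart (X : VField E M) {x₀ : M} {y : E} (hy : y ∈ (chartAt E x₀).target) :
    chartInvDeriv x₀ y (X.inChart x₀ y) = X ((chartAt E x₀).symm y) := by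
  have h := chartInvDeriv_comp_chartDeriv ((chartAt E x₀).map_target hy)
  rw [(chartAt E x₀).right_inv hy] at h
  exact DFunLike.congr_fun h (X ((chartAt E x₀).symm y) : E)

theorem contDiffAt_transition {x₀ x₁ : M} {y : E} (hy : y ∈ (chartAt E x₀).target)
    (hy₁ : (chartAt E x₀).symm y ∈ (chartAt E x₁).source) :
    ContDiffAt ℝ ∞ (chartAt E x₁ ∘ (chartAt E x₀).symm) y := by
  have h1 : ContMDiffAt 𝓘(ℝ, E) 𝓘(ℝ, E) ∞ (chartAt E x₀).symm y :=
    contMDiffAt_symm_of_mem_maximalAtlas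
      (IsManifold.subset_maximalAtlas (chart_mem_atlas E x₀)) hy
  have h2 : ContMDiffAt 𝓘(ℝ, E) 𝓘(ℝ, E) ∞ (chartAt E x₁) ((chartAt E x₀).symm y) :=
    contMDiffAt_of_mem_maximalAtlas (IsManifold.subset_maximalAtlas (chart_mem_atlas E x₁)) hy₁
  exact (h2.comp y h1).contDiffAt

theorem fderiv_transition {x₀ x₁ : M} {y : E} (hy : y ∈ (chartAt E x₀).target)
    (hy₁ : (chartAt E x₀).symm y ∈ (chartAt E x₁).source) :
    fderiv ℝ (chartAt E x₁ ∘ (chartAt E x₀).symm) y =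
      ContinuousLinearMap.comp (chartDeriv x₁ ((chartAt E x₀).symm y) : E →L[ℝ] E)
        (chartInvDeriv x₀ y : E →L[ℝ] E) := by
  have h := mfderiv_comp y
    ((mdifferentiable_chart (I := 𝓘(ℝ, E)) x₁).mdifferentiableAt hy₁)
    ((mdifferentiable_chart (I := 𝓘(ℝ, E)) x₀).mdifferentiableAt_symm hy)
  rw [mfderiv_eq_fderiv] at h
  exact h

theorem DForm.inChart_eq_pullback {k : ℕ} (β : DForm E M k) {x₀ x₁ : M} {y : E}
    (hy : y ∈ (chartAt E x₀).target) (hy₁ : (chartAt E x₀).symm y ∈ (chartAt E x₁).source) :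
    β.inChart x₀ y = (β.inChart x₁ ((chartAt E x₁ ∘ (chartAt E x₀).symm) y)).compContinuousLinearMap
      (fderiv ℝ (chartAt E x₁ ∘ (chartAt E x₀).symm) y) := by
  rw [Function.comp_apply, DForm.inChart_chartAt β hy₁, fderiv_transition hy hy₁]
  have h := chartInvDeriv_comp_chartDeriv hy₁
  ext v
  simp only [ContinuousAlternatingMap.compContinuousLinearMap_apply]
  refine congrArg (β ((chartAt E x₀).symm y)) (funext fun i => ?_)
  exact (DFunLike.congr_fun h (chartInvDeriv x₀ y (v i) : E)).symm

/-- The exterior derivative may be computed in any chart. -/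
theorem DForm.Smooth.inChart_d {k : ℕ} {β : DForm E M k} (hβ : β.Smooth) {x₀ : M} {y : E}
    (hy : y ∈ (chartAt E x₀).target) : β.d.inChart x₀ y = extDeriv (β.inChart x₀) y := by
  set z : M := (chartAt E x₀).symm y with hz
  have hz₁ : z ∈ (chartAt E z).source := mem_chart_source E z
  have hev : ∀ᶠ y' in 𝓝 y, y' ∈ (chartAt E x₀).target ∧
      (chartAt E x₀).symm y' ∈ (chartAt E z).source :=
    ((chartAt E x₀).open_target.mem_nhds hy |> Filter.Eventually.and <|
      ((chartAt E x₀).continuousAt_symm hy).eventually ((chartAt E z).open_source.mem_nhds hz₁))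
  -- At `z` the form `dβ` is defined by the chart of `z`, so the two local expressions are compared
  -- by the transition map, with whose pullback `extDeriv` commutes.
  have h1 : β.inChart x₀ =ᶠ[𝓝 y] fun y' => (β.inChart z
      ((chartAt E z ∘ (chartAt E x₀).symm) y')).compContinuousLinearMap
      (fderiv ℝ (chartAt E z ∘ (chartAt E x₀).symm) y') := by
    filter_upwards [hev] with y' h
    exact β.inChart_eq_pullback h.1 h.2
  rw [h1.extDeriv_eq, extDeriv_pullback (r := ∞)
    (f := chartAt E z ∘ (chartAt E x₀).symm) (hβ.differentiableAt z)
    (contDiffAt_transition hy hz₁)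
    (by rw [minSmoothness_of_isRCLikeNormedField]; exact WithTop.coe_le_coe.2 le_top),
    fderiv_transition hy hz₁]
  rfl

theorem DForm.Smooth.d {k : ℕ} {β : DForm E M k} (hβ : β.Smooth) : β.d.Smooth := fun x₀ =>
  (contDiffOn_extDeriv (chartAt E x₀).open_target (hβ x₀)).congr fun _ hy => hβ.inChart_d hy

theorem DForm.d_apply {k : ℕ} (β : DForm E M k) (x : M) :
    β.d x = extDeriv (β.inChart x) (chartAt E x x) := by
  change ContinuousAlternatingMap.compContinuousLinearMap (extDeriv (β.inChart x) (chartAt E x x))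
    (chartDeriv x x : E →L[ℝ] E) = _
  rw [chartDeriv_self]
  rfl

theorem DForm.Smooth.d_d {k : ℕ} {β : DForm E M k} (hβ : β.Smooth) : β.d.d = 0 := by
  funext x
  refine (DForm.d_apply β.d x).trans ?_
  have h : β.d.inChart x =ᶠ[𝓝 (chartAt E x x)] extDeriv (β.inChart x) := by
    filter_upwards [(chartAt E x).open_target.mem_nhds (mem_chart_target E x)] with y hy
    exact hβ.inChart_d hy
  rw [h.extDeriv_eq]
  exact extDeriv_extDeriv_apply
    ((hβ x).contDiffAt ((chartAt E x).open_target.mem_nhds (mem_chart_target E x)))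
    (by rw [minSmoothness_of_isRCLikeNormedField]; exact WithTop.coe_le_coe.2 le_top)

end Charts

/-! ### Naturality and smoothness of products of forms -/

section Products

variable {V W : Type*} [AddCommGroup V] [Module ℝ V] [TopologicalSpace V]
  [AddCommGroup W] [Module ℝ W] [TopologicalSpace W]

theorem wedge_compContinuousLinearMap {p q r : ℕ} (h : p + q = r) (a : V [⋀^Fin p]→L[ℝ] ℝ)
    (b : V [⋀^Fin q]→L[ℝ] ℝ) (L : W →L[ℝ] V) :
    (wedge h a b).compContinuousLinearMap L =
      wedge h (a.compContinuousLinearMap L) (b.compContinuousLinearMap L) := by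
  ext v
  simp [wedge_apply, Function.comp_def]

theorem wedgePow_compContinuousLinearMap (b : V [⋀^Fin 2]→L[ℝ] ℝ) (L : W →L[ℝ] V) (m : ℕ) :
    (wedgePow b m).compContinuousLinearMap L = wedgePow (b.compContinuousLinearMap L) m := by
  induction m with
  | zero => rfl
  | succ m ih => rw [wedgePow, wedge_compContinuousLinearMap, ih]; rfl

variable {E : Type*} [NormedAddCommGroup E] [NormedSpace ℝ E]
  {M : Type*} [TopologicalSpace M] [ChartedSpace E M]

theorem DForm.inChart_wedge {p q r : ℕ} (h : p + q = r) (β : DForm E M p) (η : DForm E M q) (x₀ : M) :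
    (DForm.wedge h β η).inChart x₀ = fun y => _root_.wedge h (β.inChart x₀ y) (η.inChart x₀ y) :=
  funext fun _ => wedge_compContinuousLinearMap h _ _ _

theorem DForm.inChart_pow (β : DForm E M 2) (m : ℕ) (x₀ : M) :
    (β.pow m).inChart x₀ = fun y => wedgePow (β.inChart x₀ y) m :=
  funext fun _ => wedgePow_compContinuousLinearMap _ _ m

theorem DForm.inChart_fmul {k : ℕ} (f : M → ℝ) (β : DForm E M k) (x₀ : M) :
    (DForm.fmul f β).inChart x₀ = fun y => f ((chartAt E x₀).symm y) • β.inChart x₀ y := rfl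

theorem DForm.Smooth.wedge [FiniteDimensional ℝ E] {p q r : ℕ} (h : p + q = r) {β : DForm E M p}
    {η : DForm E M q} (hβ : β.Smooth) (hη : η.Smooth) : (DForm.wedge h β η).Smooth := fun x₀ => by
  rw [DForm.inChart_wedge]
  exact contDiffOn_wedge h (hβ x₀) (hη x₀)

theorem DForm.Smooth.pow [FiniteDimensional ℝ E] {β : DForm E M 2} (hβ : β.Smooth) (m : ℕ) :
    (β.pow m).Smooth := fun x₀ => by
  rw [DForm.inChart_pow]
  exact contDiffOn_wedgePow (hβ x₀) m

theorem DForm.Smooth.contactVolume [FiniteDimensional ℝ E] [IsManifold 𝓘(ℝ, E) ∞ M]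
    {α : DForm E M 1} (hα : α.Smooth) (n : ℕ) : (contactVolume n α).Smooth :=
  hα.wedge _ (hα.d.pow n)

theorem DForm.Smooth.fmul {k : ℕ} {f : M → ℝ} {β : DForm E M k}
    (hf : ∀ x₀ : M, ContDiffOn ℝ ∞ (f ∘ (chartAt E x₀).symm) (chartAt E x₀).target)
    (hβ : β.Smooth) : (DForm.fmul f β).Smooth := fun x₀ => by
  rw [DForm.inChart_fmul]
  exact (hf x₀).smul (hβ x₀)

end Products

/-! ### Existence of Reeb vectors -/

section LinearAlgebra

variable {V : Type*} [AddCommGroup V] [Module ℝ V] [TopologicalSpace V]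

/-- A `2`-form on an odd-dimensional space is degenerate. -/
theorem exists_ne_zero_forall_pair_eq_zero {n : ℕ} (e : Module.Basis (Fin (2 * n + 1)) ℝ V)
    (b : V [⋀^Fin 2]→L[ℝ] ℝ) : ∃ v : V, v ≠ 0 ∧ ∀ w, b ![v, w] = 0 := by
  let B : V →ₗ[ℝ] V →ₗ[ℝ] ℝ := LinearMap.mk₂ ℝ (fun u w => b ![u, w])
    (pair_add_left b) (pair_smul_left b) (pair_add_right b) (pair_smul_right b)
  let A : Matrix (Fin (2 * n + 1)) (Fin (2 * n + 1)) ℝ := fun i j => B (e i) (e j)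
  have hA : A.transpose = -A := by
    ext i j
    exact pair_swap b (e j) (e i)
  -- The Gram matrix is antisymmetric of odd size, so `det A = -det A`.
  have hdet : A.det = 0 := by
    have h := congrArg Matrix.det hA
    rw [Matrix.det_transpose, Matrix.det_neg] at h
    simp [pow_succ, pow_mul] at h
    linarith
  obtain ⟨c, hc, hAc⟩ := Matrix.exists_mulVec_eq_zero_iff.2 hdet
  refine ⟨∑ j, c j • e j, fun h => hc ?_, fun w => ?_⟩
  · ext j
    exact Fintype.linearIndependent_iff.1 e.linearIndependent c h j
  · rw [pair_swap]
    change -(B w (∑ j, c j • e j)) = 0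
    have h : B.flip (∑ j, c j • e j) = 0 := by
      refine e.ext fun i => ?_
      have := congrFun hAc i
      simp only [Matrix.mulVec, dotProduct, Pi.zero_apply] at this
      simpa [A, mul_comm] using this
    rw [← LinearMap.flip_apply, h]
    simp

/-- A top degree form vanishes if its interior product with a nonzero vector does. -/
theorem eq_zero_of_forall_vecCons_eq_zero {N : ℕ} (e : Module.Basis (Fin (N + 1)) ℝ V)
    (μ : V [⋀^Fin (N + 1)]→L[ℝ] ℝ) {v : V} (hv : v ≠ 0)
    (h : ∀ z : Fin N → V, μ (Matrix.vecCons v z) = 0) : μ = 0 := by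
  obtain ⟨i, hi⟩ : ∃ i, e.repr v i ≠ 0 := by
    by_contra! hc
    exact hv (e.repr.map_eq_zero_iff.1 (Finsupp.ext hc))
  -- Replacing by `v` a basis vector along which `v` has a nonzero coordinate multiplies `μ(e)` by
  -- that coordinate, while the hypothesis makes the value zero.
  have h1 : μ.toAlternatingMap (Function.update e i v) = 0 := by
    have : Function.update (e : Fin (N + 1) → V) i v = i.insertNth v (i.removeNth e) := by
      rw [Fin.insertNth_removeNth]
    rw [this, AlternatingMap.map_insertNth]
    exact (congrArg _ (h _)).trans (smul_zero _)
  have h2 : μ.toAlternatingMap (Function.update e i v) =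
      e.repr v i * μ.toAlternatingMap e := by
    conv_lhs => rw [← e.sum_repr v]
    rw [AlternatingMap.map_update_sum, Finset.sum_eq_single i]
    · rw [AlternatingMap.map_update_smul, Function.update_eq_self, smul_eq_mul]
    · intro j _ hj
      rw [AlternatingMap.map_update_smul,
        AlternatingMap.map_update_self _ _ hj.symm, smul_zero]
    · simp
  have h3 : μ.toAlternatingMap e = 0 := by
    rw [h2] at h1
    exact (mul_eq_zero.1 h1).resolve_left hi
  exact ContinuousAlternatingMap.toAlternatingMap_injective
    ((AlternatingMap.map_basis_eq_zero_iff e _).1 h3)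

/-- If `a ∧ b^n` does not vanish on a space of dimension `2n+1`, there is a vector in the kernel of
`b` on which `a` is `1`. -/
theorem exists_reeb_vector {n r : ℕ} (h : 1 + 2 * n = r) (h' : r = 2 * n + 1)
    (e : Module.Basis (Fin (2 * n + 1)) ℝ V)
    (a : V [⋀^Fin 1]→L[ℝ] ℝ) (b : V [⋀^Fin 2]→L[ℝ] ℝ) (hab : wedge h a (wedgePow b n) ≠ 0) :
    ∃ v : V, a ![v] = 1 ∧ ∀ w, b ![v, w] = 0 := by
  subst h'
  obtain ⟨v, hv, hb⟩ := exists_ne_zero_forall_pair_eq_zero e b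
  -- If both `a(v)` and `ι(v)b` vanish, so does `ι(v)(a ∧ b^n)`, contradicting `hab`; otherwise `v`
  -- can be rescaled.
  by_cases hav : a ![v] = 0
  · refine absurd (eq_zero_of_forall_vecCons_eq_zero e _ hv fun z => ?_) hab
    rw [wedge_one_left_apply h rfl]
    change alternize _ (Matrix.vecCons v z) = 0
    cases n with
    | zero =>
      refine (alternize_cons_zero _ v z).trans ?_
      rw [hav, zero_mul]
    | succ n =>
      refine (alternize_cons (k := 2 * n + 1) _ v z).trans ?_
      have h1 (y : Fin (2 * n + 1) → V) : wedgePow b (n + 1) (Matrix.vecCons v y) = 0 := by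
        rw [wedgePow_succ_cons]
        simp only [hb, zero_mul, alternize_zero, mul_zero]
      simp only [h1, hav, zero_mul, mul_zero, alternize_zero, sub_zero]
  · refine ⟨(a ![v])⁻¹ • v, ?_, fun w => ?_⟩
    · have := a.toMultilinearMap.cons_smul ![] (a ![v])⁻¹ v
      exact this.trans (inv_mul_cancel₀ hav)
    · rw [pair_smul_left, hb, mul_zero]

end LinearAlgebra

/-! ### Pairing a 1-form with a vector field -/

section Pairing

variable {E : Type*} [NormedAddCommGroup E] [NormedSpace ℝ E]

/-- Lets 1-forms be treated as continuous linear functionals, for which product rules and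
commutation with integrals are at hand. -/
theorem ofSubsingletonLIE_symm_apply (a : E [⋀^Fin 1]→L[ℝ] ℝ) (u : E) :
    (ContinuousAlternatingMap.ofSubsingletonLIE (𝕜 := ℝ) (E := E) (F := ℝ) (0 : Fin 1)).symm a u = a ![u] := by
  change a _ = a _
  congr 1
  ext i
  fin_cases i
  rfl

theorem fderiv_one_form_apply {a : E → E [⋀^Fin 1]→L[ℝ] ℝ} {ξ : E → E} {x : E}
    (ha : DifferentiableAt ℝ a x) (hξ : DifferentiableAt ℝ ξ x) (w : E) :
    fderiv ℝ (fun y => a y ![ξ y]) x w = fderiv ℝ a x w ![ξ x] + a x ![fderiv ℝ ξ x w] := by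
  let L := (ContinuousAlternatingMap.ofSubsingletonLIE (𝕜 := ℝ) (E := E) (F := ℝ) (0 : Fin 1)).symm
  have h := (L.toContinuousLinearEquiv.hasFDerivAt (x := a x)).comp x ha.hasFDerivAt
  have h2 := h.clm_apply hξ.hasFDerivAt
  simp only [← ofSubsingletonLIE_symm_apply]
  refine (DFunLike.congr_fun h2.fderiv w).trans ?_
  exact add_comm _ _

theorem contDiffOn_one_form_apply {F : Type*} [NormedAddCommGroup F] [NormedSpace ℝ F]
    {N : WithTop ℕ∞} {a : F → E [⋀^Fin 1]→L[ℝ] ℝ} {ξ : F → E} {s : Set F}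
    (ha : ContDiffOn ℝ N a s) (hξ : ContDiffOn ℝ N ξ s) :
    ContDiffOn ℝ N (fun y => a y ![ξ y]) s := by
  simp only [← ofSubsingletonLIE_symm_apply]
  exact ((ContinuousAlternatingMap.ofSubsingletonLIE (𝕜 := ℝ) (E := E) (F := ℝ) (0 : Fin 1)).symm.contDiff.comp_contDiffOn
    ha).clm_apply hξ

end Pairing

/-! ### Cartan's formula and the characterisation of strictly contact fields -/

section ContactFields

variable {E : Type*} [NormedAddCommGroup E] [NormedSpace ℝ E]
  {M : Type*} [TopologicalSpace M] [ChartedSpace E M]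

/-- The expressions of a vector field in charts are smooth. -/
def VField.Smooth (X : VField E M) : Prop :=
  ∀ x₀ : M, ContDiffOn ℝ ∞ (X.inChart x₀) (chartAt E x₀).target

variable {α : DForm E M 1} {X : VField E M}

theorem differentiableAt_comp_chartAt_symm {f : M → ℝ} {x : M}
    (hf : ContDiffOn ℝ ∞ (f ∘ (chartAt E x).symm) (chartAt E x).target) :
    DifferentiableAt ℝ (f ∘ (chartAt E x).symm) (chartAt E x x) :=
  (hf.contDiffAt ((chartAt E x).open_target.mem_nhds (mem_chart_target E x))).differentiableAt
    (by simp)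

theorem VField.Smooth.differentiableAt (hX : X.Smooth) (x : M) :
    DifferentiableAt ℝ (X.inChart x) (chartAt E x x) :=
  ((hX x).contDiffAt ((chartAt E x).open_target.mem_nhds (mem_chart_target E x))).differentiableAt
    (by simp)

theorem dForm_one_ext {β η : DForm E M 1} (h : ∀ (x : M) (w : E), β x ![w] = η x ![w]) : β = η := by
  funext x
  refine ContinuousAlternatingMap.ext fun v => ?_
  have : v = ![v 0] := by ext i; fin_cases i; rfl
  rw [this]
  exact h x (v 0)

variable [IsManifold 𝓘(ℝ, E) ∞ M]

theorem contactHamiltonian_symm (α : DForm E M 1) (X : VField E M) {x₀ : M} {y : E}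
    (hy : y ∈ (chartAt E x₀).target) :
    contactHamiltonian α X ((chartAt E x₀).symm y) = α.inChart x₀ y ![X.inChart x₀ y] := by
  have h := chartInvDeriv_inChart X hy
  refine congrArg (α ((chartAt E x₀).symm y)) (funext fun i => ?_)
  fin_cases i
  exact h.symm

theorem contDiffOn_contactHamiltonian (hα : α.Smooth) (hX : X.Smooth) (x₀ : M) :
    ContDiffOn ℝ ∞ (contactHamiltonian α X ∘ (chartAt E x₀).symm) (chartAt E x₀).target :=
  (contDiffOn_one_form_apply (hα x₀) (hX x₀)).congr fun _ hy => contactHamiltonian_symm α X hy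

/-- Connects the manifold derivative in `IsBasic` with the chart derivative in Cartan's formula. -/
theorem mfderiv_eq_fderiv_comp_symm {f : M → ℝ} {x : M}
    (hf : ContDiffOn ℝ ∞ (f ∘ (chartAt E x).symm) (chartAt E x).target) (w : E) :
    mfderiv 𝓘(ℝ, E) 𝓘(ℝ, ℝ) f x w = fderiv ℝ (f ∘ (chartAt E x).symm) (chartAt E x x) w := by
  have h1 := (differentiableAt_comp_chartAt_symm hf).hasFDerivAt.hasMFDerivAt
  have h2 : HasMFDerivAt 𝓘(ℝ, E) 𝓘(ℝ, E) (chartAt E x) x (chartDeriv x x) :=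
    ((mdifferentiable_chart (I := 𝓘(ℝ, E)) x).mdifferentiableAt (mem_chart_source E x)).hasMFDerivAt
  have h3 := (h1.comp x h2).congr_of_eventuallyEq (f₁ := f) (by
    filter_upwards [(chartAt E x).open_source.mem_nhds (mem_chart_source E x)] with z hz
    simp [(chartAt E x).left_inv hz])
  rw [h3.mfderiv]
  exact congrArg (fderiv ℝ (f ∘ (chartAt E x).symm) (chartAt E x x))
    (DFunLike.congr_fun (chartDeriv_self x) w)

theorem lieDerivOneForm_apply (α : DForm E M 1) (X : VField E M) (x : M) (w : E) :
    lieDerivOneForm X α x ![w] = fderiv ℝ (α.inChart x) (chartAt E x x) (X x) ![w] +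
      α x ![fderiv ℝ (X.inChart x) (chartAt E x x) w] := by
  have h2 : lieDerivOneForm X α x =
      (fderiv ℝ (α.inChart x) (chartAt E x x) (X.inChart x (chartAt E x x)) +
        (α.inChart x (chartAt E x x)).compContinuousLinearMap
          (fderiv ℝ (X.inChart x) (chartAt E x x))).compContinuousLinearMap
        (chartDeriv x x : E →L[ℝ] E) := rfl
  rw [VField.inChart_self, DForm.inChart_self] at h2
  rw [h2, chartDeriv_self]
  refine congrArg₂ (· + ·) rfl (congrArg (α x) (funext fun i => ?_))
  fin_cases i
  rfl

/-- Cartan's formula for the Lie derivative of a `1`-form. -/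
theorem lieDerivOneForm_eq (hα : α.Smooth) (hX : X.Smooth) (x : M) (w : E) :
    lieDerivOneForm X α x ![w] =
      fderiv ℝ (contactHamiltonian α X ∘ (chartAt E x).symm) (chartAt E x x) w +
        α.d x ![X x, w] := by
  have h1 : contactHamiltonian α X ∘ (chartAt E x).symm =ᶠ[𝓝 (chartAt E x x)]
      fun y => α.inChart x y ![X.inChart x y] := by
    filter_upwards [(chartAt E x).open_target.mem_nhds (mem_chart_target E x)] with y hy
    exact contactHamiltonian_symm α X hy
  rw [h1.fderiv_eq, fderiv_one_form_apply (hα.differentiableAt x) (hX.differentiableAt x),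
    lieDerivOneForm_apply, DForm.d_apply, VField.inChart_self, DForm.inChart_self]
  refine Eq.symm ((congrArg₂ (· + ·) rfl (extDeriv_one_form_apply (E := E) _ _ _)).trans ?_)
  -- Here `p` is the derivative of `α` along `w`, paired with `X`: it occurs in `dH(w)` and, with
  -- the opposite sign, in `dα(X, w)`.
  exact (by intro p q r; ring : ∀ p q r : ℝ, p + q + (r - p) = r + q) _ _ _

theorem isStrictlyContact_iff (hα : α.Smooth) (hX : X.Smooth) :
    IsStrictlyContact α X ↔ ∀ (x : M) (w : E),
      fderiv ℝ (contactHamiltonian α X ∘ (chartAt E x).symm) (chartAt E x x) w =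
        -α.d x ![X x, w] := by
  have h : IsStrictlyContact α X ↔ ∀ (x : M) (w : E), lieDerivOneForm X α x ![w] = 0 :=
    ⟨fun h x w => by rw [h]; rfl, fun h => dForm_one_ext h⟩
  rw [h]
  refine forall₂_congr fun x w => ?_
  rw [lieDerivOneForm_eq hα hX, add_eq_zero_iff_eq_neg]

theorem isStrictlyContact_iff_isContactField_and_isBasic {n : ℕ} (hα : IsContactForm n α)
    (hdim : Module.finrank ℝ E = 2 * n + 1) (hX : X.Smooth) :
    IsStrictlyContact α X ↔ IsContactField α X ∧ IsBasic α (contactHamiltonian α X) := by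
  have hH := contDiffOn_contactHamiltonian hα.smooth hX
  constructor
  · intro h
    refine ⟨⟨0, contMDiff_const, ?_⟩, fun x v hv => ?_⟩
    · rw [h]
      funext x
      exact (zero_smul ℝ _).symm
    · refine (mfderiv_eq_fderiv_comp_symm (hH x) v).trans ?_
      refine ((isStrictlyContact_iff hα.smooth hX).1 h x v).trans ?_
      have h1 : α.d x ![X x, v] = -α.d x ![v, X x] := pair_swap (α.d x) _ _
      have h2 := hv.2 (X x)
      exact neg_eq_zero.2 (h1.trans (neg_eq_zero.2 h2))
  · rintro ⟨⟨h, -, hh⟩, hb⟩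
    have : FiniteDimensional ℝ E := FiniteDimensional.of_finrank_pos (by omega)
    -- On a Reeb vector `hα = dH + ι(X)dα` reads `h = dH(R)`, and `H` is basic.
    have h0 (x : M) : h x = 0 := by
      obtain ⟨v, hv1, hv2⟩ := exists_reeb_vector (V := E) (Nat.add_comm 1 (2 * n)) rfl
        (Module.finBasisOfFinrankEq ℝ E hdim) (α x) (α.d x) (hα.ne_zero x)
      have h1 := hb x v ⟨hv1, hv2⟩
      replace h1 := (mfderiv_eq_fderiv_comp_symm (hH x) v).symm.trans h1
      have h2 := lieDerivOneForm_eq hα.smooth hX x v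
      rw [h1, hh] at h2
      have h3 : α.d x ![X x, v] = -α.d x ![v, X x] := pair_swap (α.d x) _ _
      have h4 : α.d x ![v, X x] = 0 := hv2 (X x)
      have h6 : α x ![v] = 1 := hv1
      have h7 : h x * α x ![v] = 0 + α.d x ![X x, v] := h2
      rw [h3, h4, h6] at h7
      linarith
    rw [IsStrictlyContact, hh]
    funext x
    change h x • α x = 0
    rw [h0, zero_smul]

end ContactFields

/-! ### Closedness and cohomology for a single strictly contact field -/

section StrictlyContactFields

variable {E : Type*} [NormedAddCommGroup E] [NormedSpace ℝ E]
  {M : Type*} [TopologicalSpace M] [ChartedSpace E M] {α : DForm E M 1} {X : VField E M}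

/-- For `n = 0` there is no primitive involving `(dα)^(n-1)`, and only `0` is exact in degree `0`,
so the two forms have to agree exactly. -/
theorem interiorProd_contactVolume_zero (α : DForm E M 1) (X : VField E M) :
    interiorProd X (contactVolume 0 α) = DForm.fmul (contactHamiltonian α X) (α.d.pow 0) := by
  funext x
  refine ContinuousAlternatingMap.ext fun v => ?_
  have h := wedge_one_left_apply (V := E) (Nat.add_comm 1 (2 * 0)) rfl (α x) (wedgePow (α.d x) 0)
    (Matrix.vecCons (X x) v)
  exact h.trans (alternize_cons_zero _ (X x : E) v)

variable [IsManifold 𝓘(ℝ, E) ∞ M]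

theorem inChart_fmul_pow_d (hα : α.Smooth) (f : M → ℝ) (n : ℕ) (x : M) :
    (DForm.fmul f (α.d.pow n)).inChart x =ᶠ[𝓝 (chartAt E x x)] fun y =>
      (f ∘ (chartAt E x).symm) y • wedgePow (extDeriv (α.inChart x) y) n := by
  filter_upwards [(chartAt E x).open_target.mem_nhds (mem_chart_target E x)] with y hy
  rw [DForm.inChart_fmul, DForm.inChart_pow]
  change f _ • wedgePow (α.d.inChart x y) n = _
  rw [hα.inChart_d hy]
  rfl

theorem inChart_fmul_contactVolume (hα : α.Smooth) (f : M → ℝ) (n : ℕ) (x : M) :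
    (DForm.fmul f (contactVolume n α)).inChart x =ᶠ[𝓝 (chartAt E x x)] fun y =>
      (f ∘ (chartAt E x).symm) y • wedge (Nat.add_comm 1 (2 * n)) (α.inChart x y)
        (wedgePow (extDeriv (α.inChart x) y) n) := by
  filter_upwards [(chartAt E x).open_target.mem_nhds (mem_chart_target E x)] with y hy
  rw [DForm.inChart_fmul, contactVolume, DForm.inChart_wedge, DForm.inChart_pow]
  change f _ • wedge _ _ (wedgePow (α.d.inChart x y) n) = _
  rw [hα.inChart_d hy]
  rfl

variable [FiniteDimensional ℝ E]

/-- The form `α(X) (dα)^n` is closed for a strictly contact field `X`. -/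
theorem fmul_contactHamiltonian_pow_mem_closedForms {n : ℕ}
    (hdim : Module.finrank ℝ E < 2 * n + 2) (hα : α.Smooth) (hX : X.Smooth)
    (hc : IsStrictlyContact α X) :
    DForm.fmul (contactHamiltonian α X) (α.d.pow n) ∈ closedForms E M (2 * n) := by
  have hH := contDiffOn_contactHamiltonian hα hX
  refine ⟨(hα.d.pow n).fmul hH, ?_⟩
  funext x
  refine (DForm.d_apply _ x).trans ?_
  rw [(inChart_fmul_pow_d hα _ n x).extDeriv_eq]
  refine extDeriv_smul_wedgePow_eq_zero hdim (chartAt E x).open_target (mem_chart_target E x) (hα x)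
    (differentiableAt_comp_chartAt_symm (hH x)) (X := X x) fun w => ?_
  rw [(isStrictlyContact_iff hα hX).1 hc, DForm.d_apply]
  rfl

/-- The interior product of a strictly contact field with the contact volume form. -/
theorem interiorProd_contactVolume_succ (m : ℕ) (hα : α.Smooth) (hX : X.Smooth)
    (hc : IsStrictlyContact α X) :
    interiorProd X (contactVolume (m + 1) α) +
      ((m : ℝ) + 1) • (DForm.fmul (contactHamiltonian α X) (contactVolume m α)).d =
      ((m : ℝ) + 2) • DForm.fmul (contactHamiltonian α X) (α.d.pow (m + 1)) := by
  have hH := contDiffOn_contactHamiltonian hα hX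
  funext x
  refine ContinuousAlternatingMap.ext fun v => ?_
  have h := wedge_wedgePow_cons_add_extDeriv (m := m) (Nat.add_comm 1 (2 * (m + 1)))
    (Nat.add_comm 1 (2 * m)) (chartAt E x).open_target (mem_chart_target E x) (hα x)
    (differentiableAt_comp_chartAt_symm (hH x)) (X := X x)
    (by
      rw [Function.comp_apply, contactHamiltonian_symm α X (mem_chart_target E x),
        VField.inChart_self])
    (fun w => by rw [(isStrictlyContact_iff hα hX).1 hc, DForm.d_apply]; rfl) v
  rw [← (inChart_fmul_contactVolume hα (contactHamiltonian α X) m x).extDeriv_eq,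
    ← DForm.d_apply α x, ← DForm.d_apply, DForm.inChart_self, Function.comp_apply,
    (chartAt E x).left_inv (mem_chart_source E x)] at h
  exact h

/-- In positive degree the form is a multiple of the closed `H(dα)^n` minus an exact form. -/
theorem interiorProd_contactVolume_mem_closedForms {n : ℕ}
    (hdim : Module.finrank ℝ E < 2 * n + 2) (hα : α.Smooth) (hX : X.Smooth)
    (hc : IsStrictlyContact α X) :
    interiorProd X (contactVolume n α) ∈ closedForms E M (2 * n) := by
  have h1 := fmul_contactHamiltonian_pow_mem_closedForms hdim hα hX hc
  cases n with
  | zero => rwa [interiorProd_contactVolume_zero]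
  | succ m =>
    rw [eq_sub_of_add_eq (interiorProd_contactVolume_succ m hα hX hc)]
    have h2 : (DForm.fmul (contactHamiltonian α X) (contactVolume m α)).Smooth :=
      (hα.contactVolume m).fmul (contDiffOn_contactHamiltonian hα hX)
    exact Submodule.sub_mem _ (Submodule.smul_mem _ _ h1)
      (Submodule.smul_mem _ _ ⟨h2.d, h2.d_d⟩)

/-- The class of the interior product of a strictly contact field with the contact volume form. -/
theorem deRhamClass_interiorProd_contactVolume {n : ℕ} (hα : α.Smooth) (hX : X.Smooth)
    (hc : IsStrictlyContact α X)
    (h₁ : interiorProd X (contactVolume n α) ∈ closedForms E M (2 * n))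
    (h₂ : DForm.fmul (contactHamiltonian α X) (α.d.pow n) ∈ closedForms E M (2 * n)) :
    deRhamClass (interiorProd X (contactVolume n α)) h₁ =
      ((n : ℝ) + 1) • deRhamClass (DForm.fmul (contactHamiltonian α X) (α.d.pow n)) h₂ := by
  rw [deRhamClass, deRhamClass, ← Submodule.Quotient.mk_smul, Submodule.Quotient.eq]
  change interiorProd X (contactVolume n α) -
    ((n : ℝ) + 1) • DForm.fmul (contactHamiltonian α X) (α.d.pow n) ∈ exactForms E M (2 * n)
  cases n with
  | zero =>
    rw [interiorProd_contactVolume_zero]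
    simp
  | succ m =>
    have h := interiorProd_contactVolume_succ m hα hX hc
    have h3 : (DForm.fmul (contactHamiltonian α X) (contactVolume m α)).Smooth :=
      (hα.contactVolume m).fmul (contDiffOn_contactHamiltonian hα hX)
    -- The primitive is read off from `interiorProd_contactVolume_succ`.
    refine ⟨-((m : ℝ) + 1) • DForm.fmul (contactHamiltonian α X) (contactVolume m α),
      h3.smul _, ?_⟩
    rw [DForm.d_smul, neg_smul, eq_sub_of_add_eq h]
    push_cast
    rw [show (m : ℝ) + 1 + 1 = m + 2 by ring]
    exact (sub_sub_cancel_left _ _).symm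

end StrictlyContactFields

/-! ### Differentiation under the integral sign over a closed time interval -/

section ParametricIntegral

universe u

variable {E F : Type u} [NormedAddCommGroup E] [NormedAddCommGroup F] {f : ℝ × E → F} {U : Set E}

theorem intervalIntegrable_section (hf : ContinuousOn f (Icc (0 : ℝ) 1 ×ˢ U)) {y : E} (hy : y ∈ U) :
    IntervalIntegrable (fun t => f (t, y)) MeasureTheory.volume 0 1 :=
  ContinuousOn.intervalIntegrable (by
    rw [uIcc_of_le zero_le_one]; 
    exact hf.comp (by fun_prop) fun _ ht => ⟨ht, hy⟩)

theorem aestronglyMeasurable_section (hf : ContinuousOn f (Icc (0 : ℝ) 1 ×ˢ U)) {y : E}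
    (hy : y ∈ U) : MeasureTheory.AEStronglyMeasurable (fun t => f (t, y))
      (MeasureTheory.volume.restrict (uIoc (0 : ℝ) 1)) := by
  have := (intervalIntegrable_section hf hy).aestronglyMeasurable
  rwa [uIoc_of_le zero_le_one]

variable [NormedSpace ℝ E] [NormedSpace ℝ F]

theorem uniqueDiffOn_Icc_prod (hU : IsOpen U) : UniqueDiffOn ℝ (Icc (0 : ℝ) 1 ×ˢ U) :=
  (uniqueDiffOn_Icc zero_lt_one).prod hU.uniqueDiffOn

/-- At the endpoints of the time interval only derivatives within the product exist; restriction to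
a slice with `t` fixed still gives a genuine derivative, since `U` is open. -/
theorem hasFDerivAt_of_contDiffOn_Icc_prod (hU : IsOpen U)
    (hf : ContDiffOn ℝ ∞ f (Icc (0 : ℝ) 1 ×ˢ U)) {t : ℝ} (ht : t ∈ Icc (0 : ℝ) 1) {y : E}
    (hy : y ∈ U) : HasFDerivAt (fun y => f (t, y))
      ((fderivWithin ℝ f (Icc (0 : ℝ) 1 ×ˢ U) (t, y)).comp (ContinuousLinearMap.inr ℝ ℝ E)) y := by
  have h1 : HasFDerivWithinAt f (fderivWithin ℝ f (Icc (0 : ℝ) 1 ×ˢ U) (t, y))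
      (Icc (0 : ℝ) 1 ×ˢ U) (t, y) :=
    ((hf (t, y) ⟨ht, hy⟩).differentiableWithinAt (by simp)).hasFDerivWithinAt
  have h2 : HasFDerivWithinAt (fun y : E => (t, y)) (ContinuousLinearMap.inr ℝ ℝ E) U y :=
    (hasFDerivAt_prodMk_right t y).hasFDerivWithinAt
  exact (h1.comp y h2 fun z hz => ⟨ht, hz⟩).hasFDerivAt (hU.mem_nhds hy)

theorem contDiffOn_fderivWithin_comp_inr (hU : IsOpen U)
    (hf : ContDiffOn ℝ ∞ f (Icc (0 : ℝ) 1 ×ˢ U)) :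
    ContDiffOn ℝ ∞ (fun p => (fderivWithin ℝ f (Icc (0 : ℝ) 1 ×ˢ U) p).comp
      (ContinuousLinearMap.inr ℝ ℝ E)) (Icc (0 : ℝ) 1 ×ˢ U) :=
  (hf.fderivWithin (uniqueDiffOn_Icc_prod hU) (by simp)).clm_comp contDiffOn_const

variable [FiniteDimensional ℝ E]

theorem hasFDerivAt_intervalIntegral_of_contDiffOn (hU : IsOpen U)
    (hf : ContDiffOn ℝ ∞ f (Icc (0 : ℝ) 1 ×ˢ U)) {y : E} (hy : y ∈ U) :
    HasFDerivAt (fun y => ∫ t in (0 : ℝ)..1, f (t, y))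
      (∫ t in (0 : ℝ)..1, (fderivWithin ℝ f (Icc (0 : ℝ) 1 ×ˢ U) (t, y)).comp
        (ContinuousLinearMap.inr ℝ ℝ E)) y := by
  have hD := (contDiffOn_fderivWithin_comp_inr hU hf).continuousOn
  have : ProperSpace E := FiniteDimensional.proper ℝ E
  obtain ⟨r, hr, hrU⟩ := Metric.nhds_basis_closedBall.mem_iff.1 (hU.mem_nhds hy)
  -- Compactness of the time interval times a closed ball supplies a constant dominating function.
  obtain ⟨C, hC⟩ := (isCompact_Icc (a := (0 : ℝ)) (b := 1)).prod
    (isCompact_closedBall y r) |>.exists_bound_of_continuousOn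
      (hD.mono (prod_mono_right hrU))
  refine intervalIntegral.hasFDerivAt_integral_of_dominated_of_fderiv_le (bound := fun _ => C)
    (F := fun y t => f (t, y)) (F' := fun y t => (fderivWithin ℝ f (Icc (0 : ℝ) 1 ×ˢ U) (t, y)).comp
        (ContinuousLinearMap.inr ℝ ℝ E))
    (Metric.closedBall_mem_nhds y hr) ?_ (intervalIntegrable_section hf.continuousOn hy)
    (aestronglyMeasurable_section hD hy) ?_ intervalIntegrable_const ?_
  · filter_upwards [hU.mem_nhds hy] with z hz
    exact aestronglyMeasurable_section hf.continuousOn hz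
  · refine Filter.Eventually.of_forall fun t ht z hz => ?_
    rw [uIoc_of_le zero_le_one] at ht
    exact hC (t, z) ⟨Ioc_subset_Icc_self ht, hz⟩
  · refine Filter.Eventually.of_forall fun t ht z hz => ?_
    rw [uIoc_of_le zero_le_one] at ht
    exact hasFDerivAt_of_contDiffOn_Icc_prod hU hf (Ioc_subset_Icc_self ht) (hrU hz)

/-- The integral over a compact interval of a smooth family of functions is smooth. -/
theorem contDiffOn_intervalIntegral (hU : IsOpen U)
    (hf : ContDiffOn ℝ ∞ f (Icc (0 : ℝ) 1 ×ˢ U)) :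
    ContDiffOn ℝ ∞ (fun y => ∫ t in (0 : ℝ)..1, f (t, y)) U := by
  refine contDiffOn_infty.2 fun n => ?_
  induction n generalizing F with
  | zero =>
    refine contDiffOn_zero.2 fun y hy => ?_
    exact (hasFDerivAt_intervalIntegral_of_contDiffOn hU hf hy).continuousAt.continuousWithinAt
  -- The derivative is an integral of the same kind with values in `E →L[ℝ] F`, so the induction
  -- varies `F`; this is why `E` and `F` share a universe.
  | succ n ih =>
    push_cast
    refine (contDiffOn_succ_iff_fderiv_of_isOpen hU).2 ⟨fun y hy =>
      (hasFDerivAt_intervalIntegral_of_contDiffOn hU hf hy).differentiableAt.differentiableWithinAt,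
      fun h => ?_, ?_⟩
    · simp at h
    · exact (ih (contDiffOn_fderivWithin_comp_inr hU hf)).congr fun y hy =>
        (hasFDerivAt_intervalIntegral_of_contDiffOn hU hf hy).fderiv

theorem fderiv_intervalIntegral_apply (hU : IsOpen U)
    (hf : ContDiffOn ℝ ∞ f (Icc (0 : ℝ) 1 ×ˢ U)) {y : E} (hy : y ∈ U) (w : E) :
    IntervalIntegrable (fun t => fderiv ℝ (fun y => f (t, y)) y w) MeasureTheory.volume 0 1 ∧
    fderiv ℝ (fun y => ∫ t in (0 : ℝ)..1, f (t, y)) y w =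
      ∫ t in (0 : ℝ)..1, fderiv ℝ (fun y => f (t, y)) y w := by
  have hD := (contDiffOn_fderivWithin_comp_inr hU hf).continuousOn
  have hi := intervalIntegrable_section hD hy
  have heq : ∀ t ∈ Icc (0 : ℝ) 1, (fderivWithin ℝ f (Icc (0 : ℝ) 1 ×ˢ U) (t, y)).comp
        (ContinuousLinearMap.inr ℝ ℝ E) w = fderiv ℝ (fun y => f (t, y)) y w := fun t ht => by
    rw [(hasFDerivAt_of_contDiffOn_Icc_prod hU hf ht hy).fderiv]
  constructor
  · have : IntervalIntegrable (fun t => (fderivWithin ℝ f (Icc (0 : ℝ) 1 ×ˢ U) (t, y)).comp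
        (ContinuousLinearMap.inr ℝ ℝ E) w) MeasureTheory.volume 0 1 :=
      intervalIntegrable_section (hD.clm_apply continuousOn_const) hy
    refine this.congr fun t ht => ?_
    rw [uIoc_of_le zero_le_one] at ht
    exact heq t (Ioc_subset_Icc_self ht)
  · rw [(hasFDerivAt_intervalIntegral_of_contDiffOn hU hf hy).fderiv,
      ContinuousLinearMap.intervalIntegral_apply hi]
    refine intervalIntegral.integral_congr fun t ht => ?_
    rw [uIcc_of_le zero_le_one] at ht
    exact heq t ht

end ParametricIntegral

/-! ### Smooth families in charts -/

section Families

variable {E : Type*} [NormedAddCommGroup E] [NormedSpace ℝ E]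
  {M : Type*} [TopologicalSpace M] [ChartedSpace E M] [IsManifold 𝓘(ℝ, E) ∞ M]
  {X : ℝ → VField E M}

/-- Translates smoothness into the tangent bundle, tested in trivialisations, into smoothness of
chart expressions. -/
theorem trivializationAt_snd_eq_chartDeriv {x₀ z : M} (hz : z ∈ (chartAt E x₀).source)
    (v : TangentSpace 𝓘(ℝ, E) z) :
    (trivializationAt E (TangentSpace 𝓘(ℝ, E)) x₀ (⟨z, v⟩ : TangentBundle 𝓘(ℝ, E) M)).2 =
      chartDeriv x₀ z v := by
  have h := TangentBundle.continuousLinearMapAt_trivializationAt (I := 𝓘(ℝ, E)) hz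
  have h2 := DFunLike.congr_fun h v
  rw [Bundle.Trivialization.continuousLinearMapAt_apply,
    Bundle.Trivialization.coe_linearMapAt_of_mem _ (by simpa using hz)] at h2
  refine h2.trans ?_
  simp only [chartDeriv, mfld_simps]

theorem SmoothFamily.contDiffOn_inChart (hX : SmoothFamily X) (x₀ : M) :
    ContDiffOn ℝ ∞ (fun p : ℝ × E => (X p.1).inChart x₀ p.2)
      (Icc (0 : ℝ) 1 ×ˢ (chartAt E x₀).target) := by
  rintro ⟨t, y⟩ ⟨ht, hy⟩
  have hz := (chartAt E x₀).map_target hy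
  let e := trivializationAt E (TangentSpace 𝓘(ℝ, E)) x₀
  have h1 := (e.contMDiffWithinAt_iff (by
    rw [e.mem_source]; exact hz)).1 (hX (t, (chartAt E x₀).symm y) ⟨ht, mem_univ _⟩) |>.2
  have h2 : ContMDiffWithinAt 𝓘(ℝ, ℝ × E) (𝓘(ℝ, ℝ).prod 𝓘(ℝ, E)) ∞
      (fun p : ℝ × E => (p.1, (chartAt E x₀).symm p.2))
      (Icc (0 : ℝ) 1 ×ˢ (chartAt E x₀).target) (t, y) := by
    refine ContMDiffWithinAt.prodMk contDiff_fst.contMDiff.contMDiffAt.contMDiffWithinAt ?_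
    have h3 : ContMDiffAt 𝓘(ℝ, E) 𝓘(ℝ, E) ∞ (chartAt E x₀).symm y :=
      contMDiffAt_symm_of_mem_maximalAtlas
        (IsManifold.subset_maximalAtlas (chart_mem_atlas E x₀)) hy
    exact (ContMDiffAt.comp (t, y) h3 contDiff_snd.contMDiff.contMDiffAt).contMDiffWithinAt
  have h4 := (ContMDiffWithinAt.comp (t := Icc (0 : ℝ) 1 ×ˢ (univ : Set M)) (t, y) h1 h2
    fun p hp => ⟨hp.1, mem_univ _⟩).contDiffWithinAt
  exact h4.congr (fun p hp =>
    (trivializationAt_snd_eq_chartDeriv ((chartAt E x₀).map_target hp.2) _).symm)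
    (trivializationAt_snd_eq_chartDeriv hz _).symm

end Families

/-! ### Reduction of a family to its time average -/

section TimeAverage

variable {E : Type*} [NormedAddCommGroup E] [NormedSpace ℝ E]
  {M : Type*} [TopologicalSpace M] [ChartedSpace E M]

/-- The average over `0 ≤ t ≤ 1` of a time-dependent vector field. -/
def timeAverage (X : ℝ → VField E M) : VField E M := fun x =>
  (∫ t in (0 : ℝ)..1, (show E from X t x) : E)

variable [IsManifold 𝓘(ℝ, E) ∞ M] {X : ℝ → VField E M} {α : DForm E M 1}

theorem SmoothFamily.smooth (hX : SmoothFamily X) {t : ℝ} (ht : t ∈ Icc (0 : ℝ) 1) :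
    (X t).Smooth := fun x₀ =>
  (hX.contDiffOn_inChart x₀).comp (contDiff_prodMk_right t).contDiffOn fun _ hy => ⟨ht, hy⟩

theorem SmoothFamily.intervalIntegrable_inChart (hX : SmoothFamily X) {x₀ : M} {y : E}
    (hy : y ∈ (chartAt E x₀).target) :
    IntervalIntegrable (fun t => (X t).inChart x₀ y) MeasureTheory.volume 0 1 :=
  intervalIntegrable_section (hX.contDiffOn_inChart x₀).continuousOn hy

theorem SmoothFamily.intervalIntegrable (hX : SmoothFamily X) (x : M) :
    IntervalIntegrable (fun t => (show E from X t x)) MeasureTheory.volume 0 1 := by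
  have h := hX.intervalIntegrable_inChart (mem_chart_target E x)
  simpa only [VField.inChart_self] using! h

variable [FiniteDimensional ℝ E]

theorem SmoothFamily.clm_timeAverage (hX : SmoothFamily X) {F : Type*} [NormedAddCommGroup F]
    [NormedSpace ℝ F] [CompleteSpace F] (L : E →L[ℝ] F) (x : M) :
    L (timeAverage X x) = ∫ t in (0 : ℝ)..1, L (X t x) :=
  (L.intervalIntegral_comp_comm (hX.intervalIntegrable x)).symm

theorem SmoothFamily.inChart_timeAverage (hX : SmoothFamily X) (x₀ : M) (y : E) :
    (timeAverage X).inChart x₀ y = ∫ t in (0 : ℝ)..1, (X t).inChart x₀ y :=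
  hX.clm_timeAverage (chartDeriv x₀ ((chartAt E x₀).symm y) : E →L[ℝ] E) _

theorem SmoothFamily.smooth_timeAverage (hX : SmoothFamily X) : (timeAverage X).Smooth := fun x₀ =>
  (contDiffOn_intervalIntegral (chartAt E x₀).open_target (hX.contDiffOn_inChart x₀)).congr
    fun y _ => hX.inChart_timeAverage x₀ y

theorem SmoothFamily.contactHamiltonian_timeAverage (hX : SmoothFamily X) (α : DForm E M 1) :
    contactHamiltonian α (timeAverage X) =
      fun x => ∫ t in (0 : ℝ)..1, contactHamiltonian α (X t) x := by
  funext x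
  have h := hX.clm_timeAverage ((ContinuousAlternatingMap.ofSubsingletonLIE (𝕜 := ℝ) (E := E)
    (F := ℝ) (0 : Fin 1)).symm (α x)) x
  exact (ofSubsingletonLIE_symm_apply (E := E) (α x) _).symm.trans (h.trans
    (intervalIntegral.integral_congr fun t _ => ofSubsingletonLIE_symm_apply (E := E) (α x) _))

theorem SmoothFamily.fluxForm_eq (hX : SmoothFamily X) {k : ℕ} (μ : DForm E M (k + 1)) :
    fluxForm μ X = interiorProd (timeAverage X) μ := by
  funext x
  exact (hX.clm_timeAverage (ContinuousAlternatingMap.curryLeft (E := E) (μ x)) x).symm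

/-- At a point the Lie derivative is a fixed linear expression in the field and its first
derivatives (`hL`); both commute with the time integral. -/
theorem SmoothFamily.isStrictlyContact_timeAverage (hX : SmoothFamily X)
    (hc : ∀ t ∈ Icc (0 : ℝ) 1, IsStrictlyContact α (X t)) :
    IsStrictlyContact α (timeAverage X) := by
  refine dForm_one_ext fun x w => ?_
  let T := (ContinuousAlternatingMap.ofSubsingletonLIE (𝕜 := ℝ) (E := E) (F := ℝ) (0 : Fin 1)).symm
  let A : E →L[ℝ] ℝ :=
    (ContinuousAlternatingMap.apply ℝ E ℝ ![w]).comp (fderiv ℝ (α.inChart x) (chartAt E x x))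
  let B : E →L[ℝ] ℝ := T (α x)
  obtain ⟨hi, hd⟩ := fderiv_intervalIntegral_apply (chartAt E x).open_target
    (hX.contDiffOn_inChart x) (mem_chart_target E x) w
  have hL (Y : VField E M) : lieDerivOneForm Y α x ![w] =
      A (Y x) + B (fderiv ℝ (Y.inChart x) (chartAt E x x) w) := by
    rw [lieDerivOneForm_apply]
    exact congrArg₂ (· + ·) rfl (ofSubsingletonLIE_symm_apply (E := E) (α x) _).symm
  rw [hL, show (timeAverage X).inChart x = fun y => ∫ t in (0 : ℝ)..1, (X t).inChart x y from
    funext (hX.inChart_timeAverage x), hd, hX.clm_timeAverage A,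
    ← B.intervalIntegral_comp_comm hi]
  have hiA : IntervalIntegrable (fun t => A (X t x)) MeasureTheory.volume 0 1 :=
    ⟨A.integrable_comp (hX.intervalIntegrable x).1, A.integrable_comp (hX.intervalIntegrable x).2⟩
  have hiB : IntervalIntegrable
      (fun t => B (fderiv ℝ ((X t).inChart x) (chartAt E x x) w)) MeasureTheory.volume 0 1 :=
    ⟨B.integrable_comp hi.1, B.integrable_comp hi.2⟩
  refine (intervalIntegral.integral_add hiA hiB).symm.trans ?_
  refine (intervalIntegral.integral_congr (g := fun _ => (0 : ℝ)) fun t ht => ?_).trans (by simp; rfl)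
  rw [uIcc_of_le zero_le_one] at ht
  refine (hL (X t)).symm.trans ?_
  rw [hc t ht]
  rfl

end TimeAverage

end

/-! ### The proposition -/

theorem proposition3p1 (n : ℕ) {M : Type*} [TopologicalSpace M]
    [ChartedSpace (EuclideanSpace ℝ (Fin (2 * n + 1))) M]
    [IsManifold (𝓡 (2 * n + 1)) ∞ M]
    [CompactSpace M] [T2Space M]
    (α : DForm (EuclideanSpace ℝ (Fin (2 * n + 1))) M 1) (hα : IsContactForm n α)
    (X : ℝ → VField (EuclideanSpace ℝ (Fin (2 * n + 1))) M) (hX : SmoothFamily X)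
    (H : ℝ → M → ℝ) (hH : ∀ t ∈ Icc (0 : ℝ) 1, H t = contactHamiltonian α (X t)) :
    (∀ t ∈ Icc (0 : ℝ) 1,
      IsStrictlyContact α (X t) ↔ IsContactField α (X t) ∧ IsBasic α (H t)) ∧
    ((∀ t ∈ Icc (0 : ℝ) 1, IsStrictlyContact α (X t)) →
      (∀ t ∈ Icc (0 : ℝ) 1, DForm.fmul (H t) (α.d.pow n) ∈ closedForms _ M (2 * n)) ∧
      ∃ (h₁ : fluxForm (contactVolume n α) X ∈ closedForms _ M (2 * n))
        (h₂ : DForm.fmul (fun x => ∫ t in (0 : ℝ)..1, H t x) (α.d.pow n) ∈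
          closedForms _ M (2 * n)),
        deRhamClass (fluxForm (contactVolume n α) X) h₁ =
          ((n : ℝ) + 1) •
            deRhamClass (DForm.fmul (fun x => ∫ t in (0 : ℝ)..1, H t x) (α.d.pow n)) h₂) := by

  have hdim : Module.finrank ℝ (EuclideanSpace ℝ (Fin (2 * n + 1))) = 2 * n + 1 :=
    finrank_euclideanSpace_fin
  have hdim' : Module.finrank ℝ (EuclideanSpace ℝ (Fin (2 * n + 1))) < 2 * n + 2 := by omega
  refine ⟨fun t ht => ?_, fun hc => ⟨fun t ht => ?_, ?_⟩⟩
  · rw [hH t ht]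
    exact isStrictlyContact_iff_isContactField_and_isBasic hα hdim (hX.smooth ht)
  · rw [hH t ht]
    exact fmul_contactHamiltonian_pow_mem_closedForms hdim' hα.smooth (hX.smooth ht) (hc t ht)
  · have hXa := hX.smooth_timeAverage
    have hca := hX.isStrictlyContact_timeAverage hc
    -- With this and `fluxForm_eq`, both forms become those of the averaged field. The integral sees
    -- only times in `[0, 1]`, where `H` is prescribed.
    have hHa : (fun x => ∫ t in (0 : ℝ)..1, H t x) = contactHamiltonian α (timeAverage X) := by
      rw [hX.contactHamiltonian_timeAverage]
      funext x
      refine intervalIntegral.integral_congr fun t ht => ?_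
      rw [uIcc_of_le zero_le_one] at ht
      exact congrFun (hH t ht) x
    have h₁ := interiorProd_contactVolume_mem_closedForms hdim' hα.smooth hXa hca
    have h₂ := fmul_contactHamiltonian_pow_mem_closedForms hdim' hα.smooth hXa hca
    simp only [hHa, hX.fluxForm_eq]
    exact ⟨h₁, h₂, deRhamClass_interiorProd_contactVolume hα.smooth hXa hca h₁ h₂⟩
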